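/- **Setting.** There are $n\ge 2$ items $1,\dots,n$ with an unknown true ranking $r_1\succ r_2\succ\cdots\succ r_n$ ($r_1$ most preferred). Each comparison of two items $i\ne j$ is won by $i$ with probability $p_{i,j}$ and by $j$ with probability $p_{j,i}=1-p_{i,j}$, independently of everything else, where $p_{i,j}>1/2$ if and only if $i\succ j$. The probabilities $p_{i,j}$ are unknown and otherwise arbitrary. Put $\Delta_{i,j}=|p_{i,j}-\tfrac12|$ and $\Delta_i=\min_{j\ne i}\Delta_{i,j}$. Two artificial items $\pm\infty$ are added, with $p_{i,-\infty}=1$ and $p_{i,+\infty}=0$ for every item $i$; comparisons with them are counted as well. All logarithms are natural unless a base is shown. **Algorithm.** * *Attempting-Comparison* $\mathrm{ATC}(i,j,\epsilon,\delta)$: let $b^t=\sqrt{\frac1{2t}\log\frac{\pi^2t^2}{3\delta}}$. For $t=1,\dots,\lceil\frac1{2\epsilon^2}\log\frac2\delta\rceil$, compare $i$ and $j$ once and let $\hat p^t$ be the fraction of the first $t$ comparisons won by $i$; return $i$ if $\hat p^t>\frac12+b^t$, and return $j$ if $\hat p^t<\frac12-b^t$. After the loop return $i$ if the final fraction is $>\frac12$,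 $j$ if it is $<\frac12$, and a uniformly random one of the two if it equals $\frac12$. * *Preference interval tree* of a sorted list $S=(s_1\succ\cdots\succ s_l)$: any binary tree of depth $h=\lceil 1+\log_2(l+1)\rceil$ (counted in nodes) whose nodes $u$ carry intervals $(u.\mathrm{left},u.\mathrm{right})$, the root carrying $(-\infty,+\infty)$ and the leaves, from left to right, $(-\infty,s_l),(s_l,s_{l-1}),\dots,(s_2,s_1),(s_1,+\infty)$, and in which every inner node $u$ carries an item $u.\mathrm{mid}$ and has two children with intervals $(u.\mathrm{left},u.\mathrm{mid})$ and $(u.\mathrm{mid},u.\mathrm{right})$. One such tree is fixed in advance for each list. * *Attempting-Insertion* $\mathrm{ATI}(i,S,\epsilon,\delta)$: let $q=\frac{15}{16}$ and $t^{\max}=\lceil\max\{4h,\frac{512}{25}\log\frac2\delta\}\rceil$, let all counters $c_u$ of the leaves be $0$ and let $X$ be the root of the tree of $S$. In each round $t=1,\dots,t^{\max}$: - if $X$ is the root, move $X$ to its right child if $\mathrm{ATC}(i,X.\mathrm{mid},\epsilon,1-q)=i$, and to its left child otherwise; - if $X$ is a leaf, and $\mathrm{ATC}(i,X.\mathrm{left},\epsilon,1-\sqrt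 q)=i$ and $\mathrm{ATC}(i,X.\mathrm{right},\epsilon,1-\sqrt q)=X.\mathrm{right}$, increase $c_X$ by $1$, and if then $c_X>\frac t2+\sqrt{\frac t2\log\frac{\pi^2t^2}{3\delta}}+1$, insert $i$ into the interval of $X$ and stop; if not both hold, decrease $c_X$ by $1$ when $c_X>0$, and move $X$ to its parent when $c_X=0$; - if $X$ is any other node, move $X$ to its parent if $\mathrm{ATC}(i,X.\mathrm{left},\epsilon,1-\sqrt[3]q)=X.\mathrm{left}$ or $\mathrm{ATC}(i,X.\mathrm{right},\epsilon,1-\sqrt[3]q)=i$; otherwise move to the right child if $\mathrm{ATC}(i,X.\mathrm{mid},\epsilon,1-\sqrt[3]q)=i$, and to the left child if not. After the last round, insert $i$ into the interval of a leaf $u$ with $c_u\ge1+\frac5{16}t^{\max}$ if there is one; otherwise the result is *unsure*. * *Iterative-Attempting-Insertion* $\mathrm{IAI}(i,S,\delta)$: for $\tau=1,2,\dots$ run $\mathrm{ATI}\big(i,S,2^{-(\tau+1)},\frac{6\delta}{\pi^2\tau^2}\big)$, until $i$ has been inserted. * *Iterative-Insertion-Ranking* $\mathrm{IIR}(\delta)$: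 start with the list $(1)$, run $\mathrm{IAI}(t,\cdot,\frac{\delta}{n-1})$ on the current list for $t=2,\dots,n$, and return the final list. **Theorem.** There is a universal constant $C>0$ such that for all $n\ge2$, all $\delta\in(0,1)$, and all instances as above, with probability at least $1-\delta$ the algorithm $\mathrm{IIR}(\delta)$, which has no knowledge of the $p_{i,j}$, of the $\Delta_i$ or of the ranking, terminates, returns the true ranking $(r_1,\dots,r_n)$, and makes at most $$C\sum_{i=1}^n\Delta_i^{-2}\Big(\log\log\Delta_i^{-1}+\log\frac n\delta\Big)$$ comparisons. -/

import Mathlib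

namespace ExactRanking

/-! ### Instances -/

/-- An instance of the pairwise exact ranking problem on the items `Fin n`. `p i j` is the
probability that `i` wins a comparison of `i` and `j`. `rank k` is the item at position `k` of
the true ranking (position `0` is the most preferred item), and a higher ranked item wins with
probability more than `1/2`; nothing else is assumed. (The values `p i i` play no role.) -/
structure Instance (n : ℕ) where
  p : Fin n → Fin n → unitInterval
  p_add : ∀ i j, i ≠ j → (p i j : ℝ) + p j i = 1
  rank : Equiv.Perm (Fin n)
  half_lt : ∀ a b : Fin n, a < b → (1 / 2 : ℝ) < p (rank a) (rank b)

/-- The true ranking as a list, most preferred item first. -/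
def Instance.trueRanking {n : ℕ} (I : Instance n) : List (Fin n) := List.ofFn I.rank

/-- `Δ_{i,j} = |p_{i,j} - 1/2|`. -/
noncomputable def Instance.pairGap {n : ℕ} (I : Instance n) (i j : Fin n) : ℝ :=
  |(I.p i j : ℝ) - 1 / 2|

/-- `Δ_i = min_{j ≠ i} Δ_{i,j}`. -/
noncomputable def Instance.gap {n : ℕ} (I : Instance n) (i : Fin n) : ℝ :=
  ⨅ j : {j : Fin n // j ≠ i}, I.pairGap i j

/-- Items together with the two artificial items `-∞` and `+∞`. -/
inductive ExtItem (n : ℕ) : Type where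
  | negInf : ExtItem n
  | item (i : Fin n) : ExtItem n
  | posInf : ExtItem n

/-- Winning probabilities of an item against an extended item: `p_{i,-∞} = 1`, `p_{i,+∞} = 0`. -/
def extP {n : ℕ} (p : Fin n → Fin n → unitInterval) (i : Fin n) : ExtItem n → unitInterval
  | .negInf => 1
  | .item j => p i j
  | .posInf => 0

/-! ### Programs that make comparisons

A program has no access to the probabilities of the instance: the only way in which it can
depend on them is through the outcomes of its comparisons. -/

/-- Programs returning a value of type `α`. `compare i j` compares `i` and `j` once and returns
`true` iff `i` wins, `coin` tosses a fair coin, and `repeatUntil body` runs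
`body 1, body 2, …` until one of them returns `some a`, and then returns `a`. -/
inductive Prog (n : ℕ) : Type → Type 1 where
  | pure {α : Type} (a : α) : Prog n α
  | bind {α β : Type} (x : Prog n α) (f : α → Prog n β) : Prog n β
  | compare (i : Fin n) (j : ExtItem n) : Prog n Bool
  | coin : Prog n Bool
  | repeatUntil {α : Type} (body : ℕ → Prog n (Option α)) : Prog n α

instance (n : ℕ) : Monad (Prog n) where
  pure := Prog.pure
  bind := Prog.bind

/-- The Bernoulli distribution: `true` with probability `x`. -/
noncomputable def biasedCoin (x : unitInterval) : PMF Bool :=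
  PMF.ofFintype (fun b => ENNReal.ofReal (if b then (x : ℝ) else 1 - x)) (by
    rw [Fintype.sum_bool, ← ENNReal.ofReal_add (by simpa using x.2.1) (by simpa using x.2.2)]
    simp)

/-- At most `k` further rounds of a `repeatUntil` loop, the next round having number `t`, given
the laws `f` of (value, number of comparisons) of the rounds. -/
noncomputable def runLoop {α : Type} (f : ℕ → PMF (Option (Option α) × ℕ)) :
    (k t : ℕ) → PMF (Option α × ℕ)
  | 0, _ => PMF.pure (none, 0)
  | k + 1, t => (f t).bind fun x =>
      match x.1 with
      | none => PMF.pure (none, x.2)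
      | some none => (runLoop f k (t + 1)).map fun y => (y.1, x.2 + y.2)
      | some (some a) => PMF.pure (some a, x.2)

/-- The joint law of the returned value and the number of comparisons made, when every comparison
is made with fresh independent randomness and each `repeatUntil` loop is cut off after `fuel`
rounds. A run that is cut off returns `none`. -/
noncomputable def Prog.run {n : ℕ} (p : Fin n → Fin n → unitInterval) (fuel : ℕ) :
    {α : Type} → Prog n α → PMF (Option α × ℕ)
  | _, .pure a => PMF.pure (some a, 0)
  | _, .bind x f => (x.run p fuel).bind fun u =>
      match u.1 with
      | none => PMF.pure (none, u.2)
      | some a => ((f a).run p fuel).map fun v => (v.1, u.2 + v.2)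
  | _, .compare i j => (biasedCoin (extP p i j)).map fun b => (some b, 1)
  | _, .coin => (biasedCoin ⟨1 / 2, by norm_num, by norm_num⟩).map fun b => (some b, 0)
  | _, .repeatUntil body => runLoop (fun t => (body t).run p fuel) fuel 1

/-- The probability that the program terminates with a value `a` after `N` comparisons such that
`E a N`: the (monotone) limit over the cut-off of the loops. -/
noncomputable def Prog.prob {n : ℕ} (p : Fin n → Fin n → unitInterval) {α : Type}
    (P : Prog n α) (E : α → ℕ → Prop) : ENNReal :=
  ⨆ fuel : ℕ, (P.run p fuel).toOuterMeasure {x | ∃ a, x.1 = some a ∧ E a x.2}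

/-! ### Attempting-Comparison -/

/-- The confidence radius `b^t` of Attempting-Comparison. -/
noncomputable def atcRadius (δ : ℝ) (t : ℕ) : ℝ :=
  Real.sqrt (1 / (2 * t) * Real.log (Real.pi ^ 2 * (t : ℝ) ^ 2 / (3 * δ)))

/-- The loop of Attempting-Comparison with `k` iterations left, after `t` iterations of which `i`
has won `w`. The value `true` stands for the item `i`, and `false` for `j`. -/
noncomputable def atcLoop {n : ℕ} (i : Fin n) (j : ExtItem n) (δ : ℝ) :
    (k t w : ℕ) → Prog n Bool
  | 0, t, w =>
      if (w : ℝ) / t > 1 / 2 then pure true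
      else if (w : ℝ) / t < 1 / 2 then pure false
      else Prog.coin
  | k + 1, t, w => do
      let win ← Prog.compare i j
      let t' := t + 1
      let w' := if win then w + 1 else w
      if (w' : ℝ) / t' > 1 / 2 + atcRadius δ t' then pure true
      else if (w' : ℝ) / t' < 1 / 2 - atcRadius δ t' then pure false
      else atcLoop i j δ k t' w'

/-- Attempting-Comparison of `i` and `j`; returns `true` iff the returned item is `i`. -/
noncomputable def atc {n : ℕ} (i : Fin n) (j : ExtItem n) (ε δ : ℝ) : Prog n Bool :=
  atcLoop i j δ ⌈1 / (2 * ε ^ 2) * Real.log (2 / δ)⌉₊ 0 0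

/-! ### Preference interval trees

Sorted lists of items have their most preferred item first. -/

/-- Binary trees whose nodes carry intervals `(left, right)`, and whose inner nodes carry also
an item `mid`. -/
inductive PIT (n : ℕ) : Type where
  | leaf (left right : ExtItem n) : PIT n
  | node (left right mid : ExtItem n) (lchild rchild : PIT n) : PIT n

namespace PIT

variable {n : ℕ}

def left : PIT n → ExtItem n
  | leaf l _ => l
  | node l _ _ _ _ => l

def right : PIT n → ExtItem n
  | leaf _ r => r
  | node _ r _ _ _ => r

/-- The depth, counted in nodes. -/
def depth : PIT n → ℕ
  | leaf _ _ => 1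
  | node _ _ _ L R => max L.depth R.depth + 1

/-- The intervals of the leaves, from left to right. -/
def leafIntervals : PIT n → List (ExtItem n × ExtItem n)
  | leaf l r => [(l, r)]
  | node _ _ _ L R => L.leafIntervals ++ R.leafIntervals

/-- At each inner node, the intervals of the children split the interval of the node at `mid`. -/
def Splits : PIT n → Prop
  | leaf _ _ => True
  | node l r m L R =>
      L.left = l ∧ R.right = r ∧ L.right = m ∧ R.left = m ∧ L.Splits ∧ R.Splits

/-- The left (`false`) or right (`true`) child. -/
def child : PIT n → Bool → PIT n
  | leaf l r, _ => leaf l r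
  | node _ _ _ L _, false => L
  | node _ _ _ _ R, true => R

/-- The subtree at an address. An address lists the steps from the root to the node, the last
step first, so that the root is `[]`, the children of `X` are `false :: X` and `true :: X`, and
the parent of `X` is `X.tail`. -/
def subtree (T : PIT n) : List Bool → PIT n
  | [] => T
  | b :: X => (T.subtree X).child b

/-- The addresses of the leaves, given the address of the tree itself. -/
def leafAddresses : PIT n → List Bool → List (List Bool)
  | leaf _ _, X => [X]
  | node _ _ _ L R, X => L.leafAddresses (false :: X) ++ R.leafAddresses (true :: X)

end PIT

/-- `-∞, r_l, …, r_1, +∞` for the sorted list `S = [r_1, …, r_l]`. -/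
def endpoints {n : ℕ} (S : List (Fin n)) : List (ExtItem n) :=
  ExtItem.negInf :: (S.reverse.map ExtItem.item ++ [ExtItem.posInf])

/-- `T` is a preference interval tree of the sorted list `S`. -/
def IsPIT {n : ℕ} (S : List (Fin n)) (T : PIT n) : Prop :=
  T.depth = ⌈1 + Real.logb 2 (S.length + 1)⌉₊ ∧
  T.left = .negInf ∧ T.right = .posInf ∧
  T.leafIntervals = (endpoints S).zip (endpoints S).tail ∧
  T.Splits

/-- Every list has a preference interval tree. -/
theorem exists_isPIT {n : ℕ} (S : List (Fin n)) : ∃ T : PIT n, IsPIT S T := by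
  have key : ∀ (m : ℕ) (E : List (ExtItem n)) (a b : ExtItem n), m = E.length →
      ∃ T : PIT n, T.depth = Nat.clog 2 (m + 1) + 1 ∧ T.left = a ∧ T.right = b ∧
        T.leafIntervals = (a :: (E ++ [b])).zip (E ++ [b]) ∧ T.Splits := by
    intro m
    induction m using Nat.strong_induction_on with
    | _ m ih =>
      intro E a b hm
      rcases Nat.eq_zero_or_pos m with h0 | hpos
      · have hE : E = [] := by
          apply List.eq_nil_of_length_eq_zero
          omega
        subst hE
        subst h0
        exact ⟨.leaf a b, by simp [PIT.depth], rfl, rfl, by simp [PIT.leafIntervals], trivial⟩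
      · have hk : (m - 1) / 2 < E.length := by omega
        obtain ⟨L, hL1, hL2, hL3, hL4, hL5⟩ := ih ((m - 1) / 2) (by omega)
          (E.take ((m - 1) / 2)) a (E[(m - 1) / 2]) (by rw [List.length_take]; omega)
        obtain ⟨R, hR1, hR2, hR3, hR4, hR5⟩ := ih (m / 2) (by omega)
          (E.drop ((m - 1) / 2 + 1)) (E[(m - 1) / 2]) b (by rw [List.length_drop]; omega)
        refine ⟨.node a b (E[(m - 1) / 2]) L R, ?_, rfl, rfl, ?_, hL2, hR3, hL3, hR2, hL5, hR5⟩
        · have h1 : Nat.clog 2 ((m - 1) / 2 + 1) ≤ Nat.clog 2 (m / 2 + 1) :=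
            Nat.clog_mono_right 2 (by omega)
          have h2 : Nat.clog 2 (m + 1) = Nat.clog 2 (m / 2 + 1) + 1 := by
            rw [Nat.clog_of_two_le (by norm_num) (by omega)]
            congr 2
            omega
          simp only [PIT.depth, hL1, hR1]
          omega
        · simp only [PIT.leafIntervals, hL4, hR4]
          have hsplit : E = E.take ((m - 1) / 2) ++
              (E[(m - 1) / 2] :: E.drop ((m - 1) / 2 + 1)) := by
            simp
          generalize E.take ((m - 1) / 2) = A at *
          generalize E[(m - 1) / 2] = x at *
          generalize E.drop ((m - 1) / 2 + 1) = B at *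
          subst hsplit
          clear hL2 hL4 hm hk
          induction A generalizing a with
          | nil => simp
          | cons y A ihA => simpa using ihA y
  obtain ⟨T, h1, h2, h3, h4, h5⟩ := key S.length (S.reverse.map ExtItem.item) .negInf .posInf
    (by simp)
  refine ⟨T, ?_, h2, h3, h4, h5⟩
  have h := Real.natCeil_logb_natCast 2 (S.length + 1)
  push_cast at h
  rw [h1, add_comm 1, Nat.ceil_add_one (Real.logb_nonneg (by norm_num) (by
    have : (0 : ℝ) ≤ S.length := Nat.cast_nonneg _
    linarith)), h]

/-! ### Attempting-Insertion -/

/-- Insert `i` immediately after `k`. -/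
def insertAfter {n : ℕ} (i k : Fin n) : List (Fin n) → List (Fin n)
  | [] => [i]
  | a :: l => if a = k then a :: i :: l else a :: insertAfter i k l

/-- Insert `i` into the sorted list at the place of the leaf interval with right end `r`, that
is, immediately below `r`. -/
def insertBelow {n : ℕ} (i : Fin n) (r : ExtItem n) (S : List (Fin n)) : List (Fin n) :=
  match r with
  | .negInf => S
  | .item k => insertAfter i k S
  | .posInf => i :: S

/-- The threshold `b^t` of Attempting-Insertion. -/
noncomputable def atiThreshold (δ : ℝ) (t : ℕ) : ℝ :=
  1 / 2 * t + Real.sqrt (t / 2 * Real.log (Real.pi ^ 2 * (t : ℝ) ^ 2 / (3 * δ))) + 1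

/-- The constant `q`. -/
noncomputable def atiQ : ℝ := 15 / 16

/-- The number of rounds `t^max` of Attempting-Insertion into a list of length `l`. -/
noncomputable def atiRounds (l : ℕ) (δ : ℝ) : ℕ :=
  ⌈max (4 * (⌈1 + Real.logb 2 (1 + l)⌉₊ : ℝ)) (512 / 25 * Real.log (2 / δ))⌉₊

/-- The rounds of Attempting-Insertion of `i` into `S`, with `k` rounds left, the next round
having number `t`. `X` is the address of the moving point in the tree `T`, and `c` is the family
of the counters of the leaves. The result is `some S'` if `i` has been inserted, which turned `S`
into `S'`, and `none` if the subroutine is unsure. -/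
noncomputable def atiLoop {n : ℕ} (T : PIT n) (i : Fin n) (S : List (Fin n)) (ε δ : ℝ) :
    (k t : ℕ) → (X : List Bool) → (c : List Bool → ℕ) → Prog n (Option (List (Fin n)))
  | 0, _, _, c =>
      pure (((T.leafAddresses []).find? fun u =>
        decide ((c u : ℝ) ≥ 1 + 5 / 16 * atiRounds S.length δ)).map
          fun u => insertBelow i (T.subtree u).right S)
  | k + 1, t, X, c =>
      match T.subtree X with
      | .leaf l r => do
          let a ← atc i l ε (1 - Real.sqrt atiQ)
          let b ← atc i r ε (1 - Real.sqrt atiQ)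
          if a = true ∧ b = false then
            let c' := Function.update c X (c X + 1)
            if (c' X : ℝ) > atiThreshold δ t then pure (some (insertBelow i r S))
            else atiLoop T i S ε δ k (t + 1) X c'
          else if c X > 0 then
            atiLoop T i S ε δ k (t + 1) X (Function.update c X (c X - 1))
          else atiLoop T i S ε δ k (t + 1) X.tail c
      | .node l r m _ _ =>
          if X = [] then do
            let a ← atc i m ε (1 - atiQ)
            if a = true then atiLoop T i S ε δ k (t + 1) (true :: X) c
            else atiLoop T i S ε δ k (t + 1) (false :: X) c
          else do
            let a ← atc i l ε (1 - atiQ ^ (1 / 3 : ℝ))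
            let b ← atc i r ε (1 - atiQ ^ (1 / 3 : ℝ))
            if a = false ∨ b = true then atiLoop T i S ε δ k (t + 1) X.tail c
            else do
              let d ← atc i m ε (1 - atiQ ^ (1 / 3 : ℝ))
              if d = true then atiLoop T i S ε δ k (t + 1) (true :: X) c
              else atiLoop T i S ε δ k (t + 1) (false :: X) c

/-- Attempting-Insertion of `i` into `S`, with the preference interval tree `T` of `S`. -/
noncomputable def ati {n : ℕ} (T : PIT n) (i : Fin n) (S : List (Fin n)) (ε δ : ℝ) :
    Prog n (Option (List (Fin n))) :=
  atiLoop T i S ε δ (atiRounds S.length δ) 1 [] fun _ => 0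

/-! ### Iterative-Attempting-Insertion and Iterative-Insertion-Ranking

`tree S` is the preference interval tree that is constructed from the list `S`. -/

/-- Iterative-Attempting-Insertion of `i` into `S`; returns the new list. -/
noncomputable def iai {n : ℕ} (tree : List (Fin n) → PIT n) (i : Fin n) (S : List (Fin n))
    (δ : ℝ) : Prog n (List (Fin n)) :=
  Prog.repeatUntil fun t =>
    ati (tree S) i S (2 ^ (-((t : ℝ) + 1))) (6 * δ / (Real.pi ^ 2 * (t : ℝ) ^ 2))

/-- Iterative-Insertion-Ranking of the items `Fin n`, taken in their natural order. -/
noncomputable def iir {n : ℕ} (tree : List (Fin n) → PIT n) (δ : ℝ) : Prog n (List (Fin n)) :=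
  match List.finRange n with
  | [] => pure []
  | s :: rest => rest.foldlM (fun Ans i => iai tree i Ans (δ / ((n : ℝ) - 1))) [s]

end ExactRanking

/-! The cost needs no averaging: with confidence parameters bounded away from 0, one
Attempting-Comparison makes at most a constant times ε⁻² comparisons, so round τ of an insertion
costs at most a constant times 4^τ `atiRounds`. It remains to show that, outside an event of small
probability, item i is inserted correctly by the first round with ε ≤ Δ_i, which is about round log₂
Δ_i⁻¹. The geometric sum is then of order Δ_i⁻² times the last round count. That count is of order
log(n/δ) + log log Δ_i⁻¹, the iterated logarithm coming from the confidence δ/τ² of round τ.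

Two facts about Attempting-Comparison carry the argument. For every ε it is right with probability
at least 1/2, by symmetry and monotonicity in the winning probability (`half_le_atcVal`). If ε ≤ Δ_i
it is right with probability at least 1 - δ, by exponential supermartingales (`one_sub_le_atcVal`).
Hence each call is a coin of known direction (`exists_isBern_atc`).

In Attempting-Insertion only the counter at the current node can be nonzero. The state is therefore
measured by a potential: the tree distance to the correct leaf, plus the counter at a wrong leaf,
minus the counter at the correct leaf. Every noninserting round changes it by ±1. At a wrong leaf
one of the two endpoint tests has a false premise, so the counter grows with probability at most
1/2, whatever ε is. If ε ≤ Δ_i, the potential rises with probability at most 1/16, because the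
confidences q, √q, ∛q multiply to q = 15/16. `val_atiLoop_le` turns any function satisfying the
one-step inequalities of this walk into a bound on failure probabilities.

Two choices of that function suffice. One controls wrong insertions through a reflected fair walk,
without assuming ε ≤ Δ_i (`val_ati_wrong_le`). The other controls every failure, `unsure` included,
when ε ≤ Δ_i (`val_ati_le_of_le_gap`). Both give the confidence parameter of the round. A union
bound over rounds, summed by ζ(2), and then over the n - 1 insertions gives δ. -/

namespace ExactRanking

/-! ### Expectations under discrete laws -/

section Expectation

variable {β γ : Type*}

/-- The expectation of `g` under `μ`. -/
noncomputable def ev (μ : PMF β) (g : β → ENNReal) : ENNReal := ∑' x, μ x * g x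

theorem ev_pure (b : β) (g : β → ENNReal) : ev (PMF.pure b) g = g b := by
  classical
  unfold ev
  rw [tsum_eq_single b]
  · simp
  · intro x hx
    simp [PMF.pure_apply, hx]

theorem ev_bind (μ : PMF β) (f : β → PMF γ) (g : γ → ENNReal) :
    ev (μ.bind f) g = ev μ fun x => ev (f x) g := by
  unfold ev
  simp only [PMF.bind_apply, ← ENNReal.tsum_mul_right, ← ENNReal.tsum_mul_left]
  rw [ENNReal.tsum_comm]
  simp only [mul_assoc]

theorem ev_map (μ : PMF β) (f : β → γ) (g : γ → ENNReal) :
    ev (μ.map f) g = ev μ fun x => g (f x) := by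
  rw [← PMF.bind_pure_comp, ev_bind]
  simp only [Function.comp, ev_pure]

theorem ev_mono_support {μ : PMF β} {g g' : β → ENNReal} (h : ∀ x ∈ μ.support, g x ≤ g' x) :
    ev μ g ≤ ev μ g' := by
  refine ENNReal.tsum_le_tsum fun x => ?_
  by_cases hx : x ∈ μ.support
  · exact mul_le_mul_right (h x hx) _
  · rw [(PMF.apply_eq_zero_iff μ x).2 hx]
    simp

theorem ev_mono {μ : PMF β} {g g' : β → ENNReal} (h : ∀ x, g x ≤ g' x) : ev μ g ≤ ev μ g' :=
  ev_mono_support fun x _ => h x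

theorem ev_add (μ : PMF β) (g g' : β → ENNReal) :
    ev μ (fun x => g x + g' x) = ev μ g + ev μ g' := by
  unfold ev
  simp only [mul_add]
  exact ENNReal.tsum_add

theorem ev_const (μ : PMF β) (a : ENNReal) : ev μ (fun _ => a) = a := by
  unfold ev
  rw [ENNReal.tsum_mul_right, μ.tsum_coe, one_mul]

theorem ev_biasedCoin (x : unitInterval) (g : Bool → ENNReal) :
    ev (biasedCoin x) g =
      ENNReal.ofReal x * g true + ENNReal.ofReal (1 - x) * g false := by
  unfold ev
  rw [tsum_fintype, Fintype.sum_bool]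
  simp [biasedCoin]

end Expectation

/-! ### Sure cost bounds and Bernoulli laws of programs -/

section Programs

variable {n : ℕ} (p : Fin n → Fin n → unitInterval) (F : ℕ) {α β : Type}

theorem run_pure (a : α) : (pure a : Prog n α).run p F = PMF.pure (some a, 0) := by
  change (Prog.pure a).run p F = _
  rw [Prog.run]

theorem run_bind (P : Prog n α) (f : α → Prog n β) :
    (P >>= f).run p F = (P.run p F).bind fun u =>
      match u.1 with
      | none => PMF.pure (none, u.2)
      | some a => ((f a).run p F).map fun v => (v.1, u.2 + v.2) := by
  change (Prog.bind P f).run p F = _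
  rw [Prog.run]

theorem ev_run_bind (P : Prog n α) (f : α → Prog n β) (g : Option β × ℕ → ENNReal) :
    ev ((P >>= f).run p F) g = ev (P.run p F) fun u =>
      match u.1 with
      | none => g (none, u.2)
      | some a => ev ((f a).run p F) fun v => g (v.1, u.2 + v.2) := by
  rw [run_bind, ev_bind]
  congr 1
  funext u
  rcases u with ⟨_ | a, N⟩
  · simp only [ev_pure]
  · simp only [ev_map]

/-- The program surely terminates, after at most `B` comparisons. -/
def Within (P : Prog n α) (B : ℕ) : Prop :=
  ∀ x ∈ (P.run p F).support, x.1 ≠ none ∧ x.2 ≤ B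

variable {p F}

theorem Within.pure (a : α) (B : ℕ) : Within p F (pure a : Prog n α) B := by
  intro x hx
  rw [run_pure, PMF.support_pure, Set.mem_singleton_iff] at hx
  simp [hx]

theorem Within.mono {P : Prog n α} {B B' : ℕ} (h : Within p F P B) (hB : B ≤ B') :
    Within p F P B' := fun x hx => ⟨(h x hx).1, (h x hx).2.trans hB⟩

theorem Within.bind {P : Prog n α} {f : α → Prog n β} {B B' : ℕ} (hP : Within p F P B)
    (hf : ∀ a, Within p F (f a) B') : Within p F (P >>= f) (B + B') := by
  intro x hx
  rw [run_bind, PMF.mem_support_bind_iff] at hx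
  obtain ⟨⟨u, N⟩, hu, hx⟩ := hx
  obtain ⟨h1, h2⟩ := hP _ hu
  rcases u with _ | a
  · exact absurd rfl h1
  · simp only [PMF.mem_support_map_iff] at hx
    obtain ⟨v, hv, rfl⟩ := hx
    exact ⟨(hf a v hv).1, add_le_add h2 (hf a v hv).2⟩

theorem Within.compare (i : Fin n) (j : ExtItem n) : Within p F (Prog.compare i j) 1 := by
  intro x hx
  rw [Prog.run, PMF.mem_support_map_iff] at hx
  obtain ⟨b, -, rfl⟩ := hx
  simp

theorem Within.coin : Within p F (Prog.coin : Prog n Bool) 0 := by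
  intro x hx
  rw [Prog.run, PMF.mem_support_map_iff] at hx
  obtain ⟨b, -, rfl⟩ := hx
  simp

variable (p F)

/-- The expectation of a function of the returned value. -/
noncomputable def val (P : Prog n α) (h : Option α → ENNReal) : ENNReal :=
  ev (P.run p F) fun x => h x.1

theorem val_pure (a : α) (h : Option α → ENNReal) : val p F (pure a) h = h (some a) := by
  rw [val, run_pure, ev_pure]

theorem val_bind (P : Prog n α) (f : α → Prog n β) (h : Option β → ENNReal) :
    val p F (P >>= f) h = val p F P fun u =>
      match u with
      | none => h none
      | some a => val p F (f a) h := by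
  rw [val, ev_run_bind, val]
  congr 1

/-- The program surely terminates, with the value `true` with probability `θ`. -/
structure IsBern (P : Prog n Bool) (θ : ℝ) : Prop where
  nonneg : 0 ≤ θ
  le_one : θ ≤ 1
  law : ∀ h : Option Bool → ENNReal,
    val p F P h = ENNReal.ofReal θ * h (some true) + ENNReal.ofReal (1 - θ) * h (some false)

variable {p F}

theorem IsBern.pure (b : Bool) : IsBern p F (pure b : Prog n Bool) (if b then 1 else 0) := by
  constructor
  · split_ifs <;> norm_num
  · split_ifs <;> norm_num
  · intro h
    rw [val_pure]
    cases b <;> simp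

theorem IsBern.coin : IsBern p F (Prog.coin : Prog n Bool) (1 / 2) := by
  constructor
  · norm_num
  · norm_num
  · intro h
    rw [val, Prog.run, ev_map, ev_biasedCoin]

theorem IsBern.compare (i : Fin n) (j : ExtItem n) :
    IsBern p F (Prog.compare i j) (extP p i j) := by
  constructor
  · exact (extP p i j).2.1
  · exact (extP p i j).2.2
  · intro h
    rw [val, Prog.run, ev_map, ev_biasedCoin]

theorem IsBern.val_bind {P : Prog n Bool} {θ : ℝ} (hP : IsBern p F P θ) (f : Bool → Prog n β)
    (h : Option β → ENNReal) :
    val p F (P >>= f) h = ENNReal.ofReal θ * val p F (f true) h +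
      ENNReal.ofReal (1 - θ) * val p F (f false) h := by
  rw [ExactRanking.val_bind, hP.law]

theorem IsBern.bind {P : Prog n Bool} {θ a b : ℝ} (hP : IsBern p F P θ) {f : Bool → Prog n Bool}
    (ha : IsBern p F (f true) a) (hb : IsBern p F (f false) b) :
    IsBern p F (P >>= f) (θ * a + (1 - θ) * b) := by
  have h0 := hP.nonneg
  have h1 : 0 ≤ 1 - θ := sub_nonneg.2 hP.le_one
  have ha' := sub_nonneg.2 ha.le_one
  have hb' := sub_nonneg.2 hb.le_one
  constructor
  · have := mul_nonneg h0 ha.nonneg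
    have := mul_nonneg h1 hb.nonneg
    linarith
  · nlinarith [mul_nonneg h0 ha', mul_nonneg h1 hb']
  · intro h
    rw [hP.val_bind, ha.law, hb.law,
      show 1 - (θ * a + (1 - θ) * b) = θ * (1 - a) + (1 - θ) * (1 - b) by ring,
      ENNReal.ofReal_add (mul_nonneg h0 ha.nonneg) (mul_nonneg h1 hb.nonneg),
      ENNReal.ofReal_add (mul_nonneg h0 ha') (mul_nonneg h1 hb'),
      ENNReal.ofReal_mul h0, ENNReal.ofReal_mul h0, ENNReal.ofReal_mul h1, ENNReal.ofReal_mul h1]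
    ring

theorem IsBern.val_bind_le {P : Prog n Bool} {θ a b : ℝ} (hP : IsBern p F P θ)
    {f : Bool → Prog n β} {h : Option β → ENNReal} (ha0 : 0 ≤ a) (hb0 : 0 ≤ b)
    (ha : val p F (f true) h ≤ ENNReal.ofReal a) (hb : val p F (f false) h ≤ ENNReal.ofReal b) :
    val p F (P >>= f) h ≤ ENNReal.ofReal (θ * a + (1 - θ) * b) := by
  have h1 : 0 ≤ 1 - θ := sub_nonneg.2 hP.le_one
  rw [hP.val_bind, ENNReal.ofReal_add (mul_nonneg hP.nonneg ha0) (mul_nonneg h1 hb0),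
    ENNReal.ofReal_mul hP.nonneg, ENNReal.ofReal_mul h1]
  gcongr

end Programs

/-! ### Attempting-Comparison -/

/-- The probability that the loop of Attempting-Comparison returns `true` when each comparison is
won with probability `x`. -/
noncomputable def atcVal (x δ : ℝ) : (k t w : ℕ) → ℝ
  | 0, t, w => if (w : ℝ) / t > 1 / 2 then 1 else if (w : ℝ) / t < 1 / 2 then 0 else 1 / 2
  | k + 1, t, w =>
      x * (if ((w + 1 : ℕ) : ℝ) / (t + 1 : ℕ) > 1 / 2 + atcRadius δ (t + 1) then 1
        else if ((w + 1 : ℕ) : ℝ) / (t + 1 : ℕ) < 1 / 2 - atcRadius δ (t + 1) then 0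
        else atcVal x δ k (t + 1) (w + 1)) +
      (1 - x) * (if (w : ℝ) / (t + 1 : ℕ) > 1 / 2 + atcRadius δ (t + 1) then 1
        else if (w : ℝ) / (t + 1 : ℕ) < 1 / 2 - atcRadius δ (t + 1) then 0
        else atcVal x δ k (t + 1) w)

theorem atcRadius_nonneg (δ : ℝ) (t : ℕ) : 0 ≤ atcRadius δ t := Real.sqrt_nonneg _

theorem isBern_atcLoop {n : ℕ} {p : Fin n → Fin n → unitInterval} {F : ℕ} (i : Fin n)
    (j : ExtItem n) (δ : ℝ) (k t w : ℕ) :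
    IsBern p F (atcLoop i j δ k t w) (atcVal (extP p i j) δ k t w) := by
  induction k generalizing t w with
  | zero =>
    rw [atcLoop, atcVal]
    split_ifs
    · exact IsBern.pure true
    · exact IsBern.pure false
    · exact IsBern.coin
  | succ k ih =>
    rw [atcLoop, atcVal]
    refine (IsBern.compare i j).bind ?_ ?_
    · simp only [if_true]
      split_ifs
      · exact IsBern.pure true
      · exact IsBern.pure false
      · exact ih _ _
    · simp only [Bool.false_eq_true, if_false]
      split_ifs
      · exact IsBern.pure true
      · exact IsBern.pure false
      · exact ih _ _

theorem within_atcLoop {n : ℕ} {p : Fin n → Fin n → unitInterval} {F : ℕ} (i : Fin n)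
    (j : ExtItem n) (δ : ℝ) (k t w : ℕ) : Within p F (atcLoop i j δ k t w) k := by
  induction k generalizing t w with
  | zero =>
    rw [atcLoop]
    split_ifs
    · exact Within.pure _ _
    · exact Within.pure _ _
    · exact Within.coin
  | succ k ih =>
    rw [atcLoop, add_comm k]
    refine (Within.compare i j).bind fun b => ?_
    dsimp only
    repeat' split_ifs
    all_goals first | exact Within.pure _ _ | exact ih _ _

theorem atcVal_mem {x : ℝ} (hx0 : 0 ≤ x) (hx1 : x ≤ 1) (δ : ℝ) (k t w : ℕ) :
    0 ≤ atcVal x δ k t w ∧ atcVal x δ k t w ≤ 1 := by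
  induction k generalizing t w with
  | zero =>
    rw [atcVal]
    split_ifs <;> norm_num
  | succ k ih =>
    rw [atcVal]
    have key : ∀ w' : ℕ, ∀ y : ℝ, y = (if (w' : ℝ) / (t + 1 : ℕ) > 1 / 2 + atcRadius δ (t + 1)
        then 1 else if (w' : ℝ) / (t + 1 : ℕ) < 1 / 2 - atcRadius δ (t + 1) then 0
        else atcVal x δ k (t + 1) w') → 0 ≤ y ∧ y ≤ 1 := by
      rintro w' y rfl
      split_ifs
      · norm_num
      · norm_num
      · exact ih _ _
    have h1 := key (w + 1) _ rfl
    have h2 := key w _ rfl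
    constructor
    · have := mul_nonneg hx0 h1.1
      have := mul_nonneg (sub_nonneg.2 hx1) h2.1
      linarith
    · nlinarith [mul_le_mul_of_nonneg_left h1.2 hx0,
        mul_le_mul_of_nonneg_left h2.2 (sub_nonneg.2 hx1)]

/-- A coupling argument in analytic form: more wins can only turn a decision from `false` to `true`,
because the two stopping thresholds lie on either side of 1/2. Raising x moves weight to the winning
branch, whose value is the larger one. -/
theorem atcVal_mono {x y : ℝ} (hx0 : 0 ≤ x) (hxy : x ≤ y) (hy1 : y ≤ 1) (δ : ℝ) (k t : ℕ)
    {w v : ℕ} (hwv : w ≤ v) : atcVal x δ k t w ≤ atcVal y δ k t v := by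
  have hq : ∀ {w v : ℕ} (t : ℕ), w ≤ v → (w : ℝ) / t ≤ (v : ℝ) / t := fun t h =>
    div_le_div_of_nonneg_right (by exact_mod_cast h) (Nat.cast_nonneg t)
  induction k generalizing x y t w v with
  | zero =>
    have := hq t hwv
    rw [atcVal, atcVal]
    split_ifs <;> linarith
  | succ k ih =>
    rw [atcVal, atcVal]
    have hb := atcRadius_nonneg δ (t + 1)
    have key : ∀ {z z' : ℝ} {w v : ℕ}, 0 ≤ z → z ≤ 1 → 0 ≤ z' → z' ≤ 1 → w ≤ v →
        (∀ t : ℕ, atcVal z δ k t w ≤ atcVal z' δ k t v) →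
        (if (w : ℝ) / (t + 1 : ℕ) > 1 / 2 + atcRadius δ (t + 1)
        then 1 else if (w : ℝ) / (t + 1 : ℕ) < 1 / 2 - atcRadius δ (t + 1) then 0
        else atcVal z δ k (t + 1) w) ≤ (if (v : ℝ) / (t + 1 : ℕ) > 1 / 2 + atcRadius δ (t + 1)
        then 1 else if (v : ℝ) / (t + 1 : ℕ) < 1 / 2 - atcRadius δ (t + 1) then 0
        else atcVal z' δ k (t + 1) v) := by
      intro z z' w v hz0 hz1 hz0' hz1' hwv h
      have := hq (t + 1) hwv
      have h1 := atcVal_mem hz0 hz1 δ k (t + 1) w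
      have h2 := atcVal_mem hz0' hz1' δ k (t + 1) v
      have h3 := h (t + 1)
      split_ifs <;> linarith
    have hx1 := hxy.trans hy1
    have hy0 := hx0.trans hxy
    have h1 := key hx0 hx1 hy0 hy1 hwv fun t => ih hx0 hxy hy1 t hwv
    have h2 := key hx0 hx1 hy0 hy1 (Nat.succ_le_succ hwv) fun t =>
      ih hx0 hxy hy1 t (Nat.succ_le_succ hwv)
    have h3 := key hy0 hy1 hy0 hy1 (Nat.le_succ v) fun t =>
      ih hy0 le_rfl hy1 t (Nat.le_succ v)
    simp only [Nat.succ_eq_add_one] at h1 h2 h3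
    nlinarith [mul_le_mul_of_nonneg_left h2 hx0,
        mul_le_mul_of_nonneg_left h1 (sub_nonneg.2 hx1),
        mul_le_mul_of_nonneg_left h3 (sub_nonneg.2 hxy)]

/-- Exchanging the two items exchanges wins with losses and reflects the stopping rule. With no
comparison at all the fraction would be 0/0 = 0, which breaks the symmetry; hence `0 < t + k`. -/
theorem atcVal_symm (x δ : ℝ) {k t w : ℕ} (htk : 0 < t + k) (hw : w ≤ t) :
    atcVal x δ k t w = 1 - atcVal (1 - x) δ k t (t - w) := by
  have hq : ∀ {w t : ℕ}, 0 < t → w ≤ t → ((t - w : ℕ) : ℝ) / t = 1 - (w : ℝ) / t := by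
    intro w t ht hw
    have : (t : ℝ) ≠ 0 := by positivity
    rw [Nat.cast_sub hw]
    field_simp
  induction k generalizing t w with
  | zero =>
    rw [atcVal, atcVal, hq (by omega) hw]
    split_ifs <;> linarith
  | succ k ih =>
    rw [atcVal, atcVal]
    have hb := atcRadius_nonneg δ (t + 1)
    have key : ∀ {w v : ℕ}, w + v = t + 1 →
        (if (w : ℝ) / (t + 1 : ℕ) > 1 / 2 + atcRadius δ (t + 1)
        then 1 else if (w : ℝ) / (t + 1 : ℕ) < 1 / 2 - atcRadius δ (t + 1) then 0
        else atcVal x δ k (t + 1) w) = 1 - (if (v : ℝ) / (t + 1 : ℕ) > 1 / 2 + atcRadius δ (t + 1)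
        then 1 else if (v : ℝ) / (t + 1 : ℕ) < 1 / 2 - atcRadius δ (t + 1) then 0
        else atcVal (1 - x) δ k (t + 1) v) := by
      intro w v hwv
      obtain rfl : v = t + 1 - w := by omega
      rw [hq (by omega) (by omega), ih (by omega) (by omega : w ≤ t + 1)]
      split_ifs <;> linarith
    rw [key (w := w) (v := t - w + 1) (by omega), key (w := w + 1) (v := t - w) (by omega)]
    ring

/-- At x = 1/2 symmetry forces the value 1/2, and monotonicity does the rest. Nothing relates ε to
the gap here, which is what keeps wrong leaves harmless in early rounds. -/
theorem half_le_atcVal {x : ℝ} (hx : 1 / 2 ≤ x) (hx1 : x ≤ 1) (δ : ℝ) {k : ℕ} (hk : 0 < k) :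
    1 / 2 ≤ atcVal x δ k 0 0 := by
  have h1 := atcVal_symm (1 / 2) δ (k := k) (t := 0) (w := 0) (by omega) le_rfl
  have h2 := atcVal_mono (by norm_num) hx hx1 δ k 0 (le_refl 0)
  norm_num at h1 h2 ⊢
  linarith

/-! ### Exponential moments and the error budget of Attempting-Comparison -/

theorem bernoulli_mgf_le {x a : ℝ} (hx : 1 / 2 ≤ x) (ha : 0 ≤ a) :
    x * Real.exp (-a) + (1 - x) * Real.exp a ≤ Real.exp (a ^ 2 / 2) := by
  have h1 : Real.exp (-a) ≤ Real.exp a := Real.exp_le_exp.2 (by linarith)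
  have h2 := Real.cosh_le_exp_half_sq a
  rw [Real.cosh_eq] at h2
  nlinarith

theorem sum_inv_sq_le (s : Finset ℕ) : ∑ t ∈ s, 1 / (t : ℝ) ^ 2 ≤ Real.pi ^ 2 / 6 := by
  rw [← hasSum_zeta_two.tsum_eq]
  exact hasSum_zeta_two.summable.sum_le_tsum s fun i _ => by positivity

/-- The removed terms t = 1, 2 contribute 1 + 1/4. Dropping them saves enough of the budget to leave
room for the error after the last round of Attempting-Insertion. -/
theorem sum_inv_sq_tail_le {s : Finset ℕ} (hs : ∀ t ∈ s, 3 ≤ t) :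
    ∑ t ∈ s, 1 / (t : ℝ) ^ 2 ≤ Real.pi ^ 2 / 6 - 5 / 4 := by
  have h1 : 1 ∉ insert 2 s := by
    intro h
    rcases Finset.mem_insert.1 h with h | h
    · omega
    · have := hs 1 h
      omega
  have h2 : 2 ∉ s := fun h => by
    have := hs 2 h
    omega
  have := sum_inv_sq_le (insert 1 (insert 2 s))
  rw [Finset.sum_insert h1, Finset.sum_insert h2] at this
  norm_num at this ⊢
  linarith

/-- The logarithm that occurs in the confidence radii. -/
theorem exp_neg_log_pi_sq {δ : ℝ} (hδ : 0 < δ) {t : ℕ} (ht : 0 < t) :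
    Real.exp (-Real.log (Real.pi ^ 2 * (t : ℝ) ^ 2 / (3 * δ))) =
      3 * δ / Real.pi ^ 2 * (1 / (t : ℝ) ^ 2) := by
  have hpi := Real.pi_pos
  have ht' : (0 : ℝ) < t := by exact_mod_cast ht
  rw [Real.exp_neg, Real.exp_log (by positivity)]
  field_simp

theorem log_pi_sq_nonneg {δ : ℝ} (hδ : 0 < δ) (hδ1 : δ ≤ 1) {t : ℕ} (ht : 0 < t) :
    0 ≤ Real.log (Real.pi ^ 2 * (t : ℝ) ^ 2 / (3 * δ)) := by
  apply Real.log_nonneg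
  rw [le_div_iff₀ (by positivity)]
  have h3 := Real.pi_gt_three
  have ht' : (1 : ℝ) ≤ t := by exact_mod_cast ht
  have h9 : 9 ≤ Real.pi ^ 2 := by nlinarith
  have ht2 : 1 ≤ (t : ℝ) ^ 2 := by nlinarith
  nlinarith

theorem sum_exp_neg_log_le {δ : ℝ} (hδ : 0 < δ) {s : Finset ℕ} (hs : ∀ t ∈ s, 0 < t) :
    ∑ t ∈ s, Real.exp (-Real.log (Real.pi ^ 2 * (t : ℝ) ^ 2 / (3 * δ))) ≤ δ / 2 := by
  rw [Finset.sum_congr rfl fun t ht => exp_neg_log_pi_sq hδ (hs t ht), ← Finset.mul_sum]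
  have hpi := Real.pi_pos
  calc _ ≤ 3 * δ / Real.pi ^ 2 * (Real.pi ^ 2 / 6) := by
        gcongr
        exact sum_inv_sq_le s
    _ = δ / 2 := by
        field_simp
        norm_num

theorem sum_exp_neg_log_tail_le {δ : ℝ} (hδ : 0 < δ) {s : Finset ℕ} (hs : ∀ t ∈ s, 3 ≤ t) :
    ∑ t ∈ s, Real.exp (-Real.log (Real.pi ^ 2 * (t : ℝ) ^ 2 / (3 * δ))) ≤ δ / 5 := by
  rw [Finset.sum_congr rfl fun t ht => exp_neg_log_pi_sq hδ (by linarith [hs t ht]),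
    ← Finset.mul_sum]
  have hpi := Real.pi_pos
  have hpi' := Real.pi_lt_d2
  have hsq : Real.pi ^ 2 ≤ 10 := by nlinarith
  calc _ ≤ 3 * δ / Real.pi ^ 2 * (Real.pi ^ 2 / 6 - 5 / 4) := by
        gcongr
        exact sum_inv_sq_tail_le hs
    _ ≤ δ / 5 := by
        rw [div_mul_eq_mul_div, div_le_iff₀ (by positivity)]
        nlinarith

/-- The optimal Chernoff tilt: it balances the two summands at x = 1/2 + ε, where their sum is √(1 -
4ε²) ≤ exp(-2ε²). The sum decreases in x because μ ≥ 0. -/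
theorem exists_tilt {ε : ℝ} (h0 : 0 < ε) (h1 : ε < 1 / 2) :
    ∃ μ : ℝ, 0 ≤ μ ∧ ∀ x : ℝ, 1 / 2 + ε ≤ x →
      x * Real.exp (-μ) + (1 - x) * Real.exp μ ≤ Real.exp (-2 * ε ^ 2) := by
  have hr : 1 ≤ (1 + 2 * ε) / (1 - 2 * ε) := by
    rw [le_div_iff₀ (by linarith)]
    linarith
  set μ := 1 / 2 * Real.log ((1 + 2 * ε) / (1 - 2 * ε)) with hμ
  have hμ0 : 0 ≤ μ := mul_nonneg (by norm_num) (Real.log_nonneg hr)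
  refine ⟨μ, hμ0, fun x hx => ?_⟩
  have hle : Real.exp (-μ) ≤ Real.exp μ := Real.exp_le_exp.2 (by linarith)
  have hsq : Real.exp μ * Real.exp μ * (1 - 2 * ε) = 1 + 2 * ε := by
    rw [← Real.exp_add, hμ, ← add_mul, add_halves, one_mul, Real.exp_log (by linarith)]
    exact div_mul_cancel₀ _ (by linarith)
  have hinv : Real.exp (-μ) * Real.exp μ = 1 := by
    rw [← Real.exp_add]
    simp
  have heq : Real.exp (-μ) * (1 + 2 * ε) = Real.exp μ * (1 - 2 * ε) := by
    rw [← hsq]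
    linear_combination (Real.exp μ * (1 - 2 * ε)) * hinv
  have hmain : Real.exp μ * (1 - 2 * ε) ≤ Real.exp (-2 * ε ^ 2) := by
    refine abs_le_of_sq_le_sq' ?_ (Real.exp_pos _).le |>.2
    have h4 : (Real.exp (-2 * ε ^ 2)) ^ 2 = Real.exp (-(4 * ε ^ 2)) := by
      rw [← Real.exp_nat_mul]
      congr 1
      push_cast
      ring
    have h5 := Real.add_one_le_exp (-(4 * ε ^ 2))
    rw [h4]
    nlinarith
  nlinarith

/-- The term of the exponential bound that belongs to a wrong decision after `s` comparisons. -/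
noncomputable def atcTerm (δ : ℝ) (s t w : ℕ) : ℝ :=
  Real.exp (-(4 * atcRadius δ s) * (w - t / 2) - 4 * atcRadius δ s * (s * atcRadius δ s) +
    (4 * atcRadius δ s) ^ 2 * (s - t) / 8)

/-- The supermartingale property for the tilt λ = 4b. A comparison costs the factor exp(λ²/8), which
is what the last summand of the exponent releases as t grows. -/
theorem atcTerm_step {x : ℝ} (hx : 1 / 2 ≤ x) (δ : ℝ) (s t w : ℕ) :
    x * atcTerm δ s (t + 1) (w + 1) + (1 - x) * atcTerm δ s (t + 1) w ≤ atcTerm δ s t w := by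
  have hb := atcRadius_nonneg δ s
  unfold atcTerm
  set b := atcRadius δ s
  have h := bernoulli_mgf_le hx (a := 2 * b) (by linarith)
  have e1 : Real.exp (-(4 * b) * (((w + 1 : ℕ) : ℝ) - (t + 1 : ℕ) / 2) - 4 * b * (s * b) +
      (4 * b) ^ 2 * (s - (t + 1 : ℕ)) / 8) = Real.exp (-(4 * b) * (w - t / 2) -
      4 * b * (s * b) + (4 * b) ^ 2 * (s - t) / 8 - (2 * b) ^ 2 / 2) * Real.exp (-(2 * b)) := by
    rw [← Real.exp_add]
    congr 1
    push_cast
    ring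
  have e2 : Real.exp (-(4 * b) * ((w : ℝ) - (t + 1 : ℕ) / 2) - 4 * b * (s * b) +
      (4 * b) ^ 2 * (s - (t + 1 : ℕ)) / 8) = Real.exp (-(4 * b) * (w - t / 2) -
      4 * b * (s * b) + (4 * b) ^ 2 * (s - t) / 8 - (2 * b) ^ 2 / 2) * Real.exp (2 * b) := by
    rw [← Real.exp_add]
    congr 1
    push_cast
    ring
  rw [e1, e2]
  calc _ = Real.exp (-(4 * b) * (w - t / 2) -
      4 * b * (s * b) + (4 * b) ^ 2 * (s - t) / 8 - (2 * b) ^ 2 / 2) *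
        (x * Real.exp (-(2 * b)) + (1 - x) * Real.exp (2 * b)) := by ring
    _ ≤ Real.exp (-(4 * b) * (w - t / 2) -
      4 * b * (s * b) + (4 * b) ^ 2 * (s - t) / 8 - (2 * b) ^ 2 / 2) *
        Real.exp ((2 * b) ^ 2 / 2) := by gcongr
    _ = _ := by
      rw [← Real.exp_add]
      congr 1
      ring

theorem one_le_atcTerm {δ : ℝ} {s w : ℕ} (hs : 0 < s)
    (h : (w : ℝ) / s < 1 / 2 - atcRadius δ s) : 1 ≤ atcTerm δ s s w := by
  have hb := atcRadius_nonneg δ s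
  have hs' : (0 : ℝ) < s := by exact_mod_cast hs
  rw [div_lt_iff₀ hs'] at h
  apply Real.one_le_exp
  nlinarith

/-- A union bound carried out by backward induction: a wrong answer is either an early stop after
some s comparisons, charged to the term of s, or a wrong majority at the end, charged to the tilted
exponential with μ. Both are at least 1 on their events. -/
theorem one_sub_atcVal_le {x ε μ : ℝ} (δ : ℝ) (hx : 1 / 2 ≤ x) (hx1 : x ≤ 1) (hμ : 0 ≤ μ)
    (h : x * Real.exp (-μ) + (1 - x) * Real.exp μ ≤ Real.exp (-2 * ε ^ 2)) {k t w : ℕ} (hwt : w ≤ t) :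
    1 - atcVal x δ k t w ≤ ∑ s ∈ Finset.Ico (t + 1) (t + k + 1), atcTerm δ s t w +
      Real.exp (-μ * (2 * w - t) - 2 * ε ^ 2 * k) := by
  induction k generalizing t w with
  | zero =>
    rw [atcVal]
    simp only [add_zero, Finset.Ico_self, Finset.sum_empty, zero_add, Nat.cast_zero, mul_zero,
      sub_zero]
    have hpos := Real.exp_pos (-μ * (2 * w - t))
    by_cases hw : (w : ℝ) / t > 1 / 2
    · rw [if_pos hw]
      linarith
    · rw [if_neg hw]
      have h1 : 1 ≤ Real.exp (-μ * (2 * w - t)) := by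
        apply Real.one_le_exp
        rcases Nat.eq_zero_or_pos t with rfl | ht
        · simp [Nat.le_zero.1 hwt]
        · have ht' : (0 : ℝ) < t := by exact_mod_cast ht
          rw [gt_iff_lt, lt_div_iff₀ ht', not_lt] at hw
          nlinarith
      split_ifs <;> linarith
  | succ k ih =>
    rw [atcVal]
    have key : ∀ w' : ℕ, w' ≤ t + 1 →
        1 - (if (w' : ℝ) / (t + 1 : ℕ) > 1 / 2 + atcRadius δ (t + 1) then 1
        else if (w' : ℝ) / (t + 1 : ℕ) < 1 / 2 - atcRadius δ (t + 1) then 0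
        else atcVal x δ k (t + 1) w') ≤
        ∑ s ∈ Finset.Ico (t + 1) (t + (k + 1) + 1), atcTerm δ s (t + 1) w' +
        Real.exp (-μ * (2 * w' - (t + 1 : ℕ)) - 2 * ε ^ 2 * k) := by
      intro w' hw'
      rw [Finset.sum_eq_sum_Ico_succ_bot (by omega)]
      have h1 := ih hw'
      rw [show t + 1 + k + 1 = t + (k + 1) + 1 by ring] at h1
      have h2 : 0 ≤ ∑ s ∈ Finset.Ico (t + 1 + 1) (t + (k + 1) + 1), atcTerm δ s (t + 1) w' :=
        Finset.sum_nonneg fun s _ => (Real.exp_pos _).le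
      have h3 : 0 ≤ atcTerm δ (t + 1) (t + 1) w' := (Real.exp_pos _).le
      have h4 := Real.exp_pos (-μ * (2 * w' - (t + 1 : ℕ)) - 2 * ε ^ 2 * k)
      split_ifs with c1 c2
      · linarith
      · have := one_le_atcTerm (Nat.succ_pos t) c2
        simp only [Nat.succ_eq_add_one] at this
        linarith
      · linarith
    have hsum : x * ∑ s ∈ Finset.Ico (t + 1) (t + (k + 1) + 1), atcTerm δ s (t + 1) (w + 1) +
        (1 - x) * ∑ s ∈ Finset.Ico (t + 1) (t + (k + 1) + 1), atcTerm δ s (t + 1) w ≤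
        ∑ s ∈ Finset.Ico (t + 1) (t + (k + 1) + 1), atcTerm δ s t w := by
      rw [Finset.mul_sum, Finset.mul_sum, ← Finset.sum_add_distrib]
      exact Finset.sum_le_sum fun s _ => atcTerm_step hx δ s t w
    have hfin : x * Real.exp (-μ * (2 * (w + 1 : ℕ) - (t + 1 : ℕ)) - 2 * ε ^ 2 * k) +
        (1 - x) * Real.exp (-μ * (2 * w - (t + 1 : ℕ)) - 2 * ε ^ 2 * k) ≤
        Real.exp (-μ * (2 * w - t) - 2 * ε ^ 2 * (k + 1 : ℕ)) := by
      have e1 : Real.exp (-μ * (2 * (w + 1 : ℕ) - (t + 1 : ℕ)) - 2 * ε ^ 2 * k) =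
          Real.exp (-μ * (2 * w - t) - 2 * ε ^ 2 * k) * Real.exp (-μ) := by
        rw [← Real.exp_add]
        congr 1
        push_cast
        ring
      have e2 : Real.exp (-μ * (2 * w - (t + 1 : ℕ)) - 2 * ε ^ 2 * k) =
          Real.exp (-μ * (2 * w - t) - 2 * ε ^ 2 * k) * Real.exp μ := by
        rw [← Real.exp_add]
        congr 1
        push_cast
        ring
      have e3 : Real.exp (-μ * (2 * w - t) - 2 * ε ^ 2 * (k + 1 : ℕ)) =
          Real.exp (-μ * (2 * w - t) - 2 * ε ^ 2 * k) * Real.exp (-2 * ε ^ 2) := by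
        rw [← Real.exp_add]
        congr 1
        push_cast
        ring
      rw [e1, e2, e3]
      calc _ = Real.exp (-μ * (2 * w - t) - 2 * ε ^ 2 * k) *
            (x * Real.exp (-μ) + (1 - x) * Real.exp μ) := by ring
        _ ≤ _ := by gcongr
    have k1 := mul_le_mul_of_nonneg_left (key (w + 1) (by omega)) (by linarith : 0 ≤ x)
    have k2 := mul_le_mul_of_nonneg_left (key w (by omega)) (by linarith : 0 ≤ 1 - x)
    linarith

theorem one_sub_le_atcVal {x ε δ : ℝ} (hε : 0 < ε) (hε1 : ε < 1 / 2) (hx : 1 / 2 + ε ≤ x)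
    (hx1 : x ≤ 1) (hδ : 0 < δ) (hδ1 : δ ≤ 1) :
    1 - δ ≤ atcVal x δ ⌈1 / (2 * ε ^ 2) * Real.log (2 / δ)⌉₊ 0 0 := by
  obtain ⟨μ, hμ, h⟩ := exists_tilt hε hε1
  set K := ⌈1 / (2 * ε ^ 2) * Real.log (2 / δ)⌉₊ with hK
  have hmain := one_sub_atcVal_le δ (by linarith) hx1 hμ (h x hx) (k := K) (le_refl 0)
  -- At the start the exponent is -4sb² + 2sb² = -2sb², which the choice of the radius b makes equal
  -- to minus the logarithm.
  have hterm : ∀ s ∈ Finset.Ico 1 (K + 1), atcTerm δ s 0 0 =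
      Real.exp (-Real.log (Real.pi ^ 2 * (s : ℝ) ^ 2 / (3 * δ))) := by
    intro s hs
    have hs0 : 0 < s := (Finset.mem_Ico.1 hs).1
    have hs' : (0 : ℝ) < s := by exact_mod_cast hs0
    have hL := log_pi_sq_nonneg hδ hδ1 hs0
    have hb : atcRadius δ s ^ 2 = 1 / (2 * s) * Real.log (Real.pi ^ 2 * (s : ℝ) ^ 2 / (3 * δ)) :=
      Real.sq_sqrt (by positivity)
    unfold atcTerm
    congr 1
    set L := Real.log (Real.pi ^ 2 * (s : ℝ) ^ 2 / (3 * δ))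
    have : (s : ℝ) * atcRadius δ s ^ 2 = L / 2 := by
      rw [hb]
      field_simp
    push_cast
    linear_combination (-2) * this
  have hsum : ∑ s ∈ Finset.Ico 1 (K + 1), atcTerm δ s 0 0 ≤ δ / 2 := by
    rw [Finset.sum_congr rfl hterm]
    exact sum_exp_neg_log_le hδ fun t ht => (Finset.mem_Ico.1 ht).1
  have hfin : Real.exp (-(2 * ε ^ 2 * K)) ≤ δ / 2 := by
    have h1 : Real.log (2 / δ) ≤ 2 * ε ^ 2 * K := by
      have := Nat.le_ceil (1 / (2 * ε ^ 2) * Real.log (2 / δ))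
      rw [← hK, div_mul_eq_mul_div, one_mul, div_le_iff₀ (by positivity)] at this
      linarith
    calc _ ≤ Real.exp (-Real.log (2 / δ)) := Real.exp_le_exp.2 (by linarith)
      _ = δ / 2 := by
        rw [Real.exp_neg, Real.exp_log (by positivity), inv_div]
  simp only [zero_add, Nat.cast_zero, mul_zero, sub_zero, zero_sub] at hmain
  linarith

/-! ### Positions, gaps and the true ranking -/

section Instances

variable {n : ℕ} (I : Instance n)

/-- The position of an extended item in the true ranking. -/
def Instance.pos : ExtItem n → ℤ
  | .negInf => n
  | .item j => (I.rank.symm j : ℕ)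
  | .posInf => -1

/-- Whether `i` is ranked above the extended item `e`. -/
def Instance.above (i : Fin n) (e : ExtItem n) : Bool := decide (I.pos (.item i) < I.pos e)

theorem Instance.pos_injective {i j : Fin n} (h : I.pos (.item i) = I.pos (.item j)) : i = j := by
  have h' : ((I.rank.symm i : ℕ) : ℤ) = (I.rank.symm j : ℕ) := h
  exact I.rank.symm.injective (Fin.ext (by exact_mod_cast h'))

theorem Instance.half_lt_of_pos_lt {i j : Fin n} (h : I.pos (.item i) < I.pos (.item j)) :
    (1 / 2 : ℝ) < I.p i j := by
  have h' : ((I.rank.symm i : ℕ) : ℤ) < (I.rank.symm j : ℕ) := h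
  have := I.half_lt (I.rank.symm i) (I.rank.symm j) (Fin.lt_def.2 (by exact_mod_cast h'))
  simpa using this

theorem Instance.gap_le_pairGap {i j : Fin n} (h : j ≠ i) : I.gap i ≤ I.pairGap i j :=
  ciInf_le (f := fun j : {j : Fin n // j ≠ i} => I.pairGap i j) (Set.finite_range _).bddBelow ⟨j, h⟩

theorem Instance.pairGap_le_half (i j : Fin n) : I.pairGap i j ≤ 1 / 2 := by
  have h0 := (I.p i j).2.1
  have h1 := (I.p i j).2.2
  rw [Instance.pairGap, abs_le]
  constructor <;> linarith

theorem exists_ne_of_two_le (hn : 2 ≤ n) (i : Fin n) : ∃ j : Fin n, j ≠ i :=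
  have : Nontrivial (Fin n) := Fin.nontrivial_iff_two_le.2 hn
  exists_ne i

theorem Instance.gap_le_half (hn : 2 ≤ n) (i : Fin n) : I.gap i ≤ 1 / 2 := by
  obtain ⟨j, hj⟩ := exists_ne_of_two_le hn i
  exact (I.gap_le_pairGap hj).trans (I.pairGap_le_half i j)

theorem Instance.pos_lt_or_lt {i j : Fin n} (h : j ≠ i) :
    I.pos (.item i) < I.pos (.item j) ∨ I.pos (.item j) < I.pos (.item i) :=
  lt_or_gt_of_ne fun h' => h (I.pos_injective h').symm

theorem Instance.gap_pos (hn : 2 ≤ n) (i : Fin n) : 0 < I.gap i := by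
  obtain ⟨j, hj⟩ := exists_ne_of_two_le hn i
  have : Nonempty {j : Fin n // j ≠ i} := ⟨⟨j, hj⟩⟩
  obtain ⟨⟨k, hk⟩, hk'⟩ := exists_eq_ciInf_of_finite
    (f := fun j : {j : Fin n // j ≠ i} => I.pairGap i j)
  rw [Instance.gap, ← hk', Instance.pairGap, abs_pos]
  rcases I.pos_lt_or_lt hk with h | h
  · have := I.half_lt_of_pos_lt h
    exact (sub_pos.2 this).ne'
  · have := I.half_lt_of_pos_lt h
    have := I.p_add i k hk.symm
    dsimp only
    intro h'
    linarith

theorem Instance.extP_of_above {i : Fin n} {e : ExtItem n} (hn : 2 ≤ n) (he : e ≠ .item i)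
    (h : I.above i e = true) : 1 / 2 + I.gap i ≤ extP I.p i e := by
  have h' : I.pos (.item i) < I.pos e := by simpa [Instance.above] using h
  rcases e with _ | j | _
  · have := I.gap_le_half hn i
    simp only [extP, Set.Icc.coe_one]
    linarith
  · have hj : j ≠ i := fun hj => he (by rw [hj])
    have h1 := I.half_lt_of_pos_lt h'
    have h2 := I.gap_le_pairGap hj
    rw [Instance.pairGap, abs_of_pos (sub_pos.2 h1)] at h2
    simp only [extP]
    linarith
  · simp only [Instance.pos] at h'
    omega

theorem Instance.extP_of_not_above {i : Fin n} {e : ExtItem n} (hn : 2 ≤ n) (he : e ≠ .item i)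
    (h : I.above i e = false) : (extP I.p i e : ℝ) ≤ 1 / 2 - I.gap i := by
  have h' : ¬ I.pos (.item i) < I.pos e := by simpa [Instance.above] using h
  rcases e with _ | j | _
  · simp only [Instance.pos] at h'
    have := (I.rank.symm i).2
    omega
  · have hj : j ≠ i := fun hj => he (by rw [hj])
    have h1 := I.half_lt_of_pos_lt ((I.pos_lt_or_lt hj).resolve_left h')
    have h2 := I.gap_le_pairGap hj
    have h3 := I.p_add i j hj.symm
    rw [Instance.pairGap, abs_of_neg (by linarith)] at h2
    simp only [extP]
    linarith
  · have := I.gap_le_half hn i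
    simp only [extP, Set.Icc.coe_zero]
    linarith

/-- All that the analysis of insertions uses about Attempting-Comparison. The case of an item ranked
below is reduced to the other one by symmetry. -/
theorem exists_isBern_atc {F : ℕ} (hn : 2 ≤ n) {i : Fin n} {e : ExtItem n} (he : e ≠ .item i)
    {ε δ : ℝ} (hε : 0 < ε) (hε1 : ε < 1 / 2) (hδ : 0 < δ) (hδ1 : δ ≤ 1) :
    ∃ θ, IsBern I.p F (atc i e ε δ) θ ∧ (I.above i e = true → 1 / 2 ≤ θ) ∧
      (I.above i e = false → θ ≤ 1 / 2) ∧
      (ε ≤ I.gap i → (I.above i e = true → 1 - δ ≤ θ) ∧ (I.above i e = false → θ ≤ δ)) := by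
  have hg := I.gap_pos hn i
  have h0 := (extP I.p i e).2.1
  have h1 := (extP I.p i e).2.2
  -- At least one comparison is made, so the degenerate fraction 0/0 never decides.
  have hK : 0 < ⌈1 / (2 * ε ^ 2) * Real.log (2 / δ)⌉₊ := by
    rw [Nat.ceil_pos]
    have : 0 < Real.log (2 / δ) := Real.log_pos (by rw [lt_div_iff₀ hδ]; linarith)
    positivity
  have hsymm := atcVal_symm (extP I.p i e) δ (k := ⌈1 / (2 * ε ^ 2) * Real.log (2 / δ)⌉₊)
    (t := 0) (w := 0) (by omega) le_rfl
  rw [Nat.sub_zero] at hsymm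
  refine ⟨_, isBern_atcLoop i e δ _ 0 0, fun h => ?_, fun h => ?_, fun hεg =>
    ⟨fun h => ?_, fun h => ?_⟩⟩
  · have := I.extP_of_above hn he h
    exact half_le_atcVal (by linarith) h1 δ hK
  · have := I.extP_of_not_above hn he h
    rw [hsymm]
    have := half_le_atcVal (x := 1 - extP I.p i e) (by linarith) (by linarith) δ hK
    linarith
  · have := I.extP_of_above hn he h
    exact one_sub_le_atcVal hε hε1 (by linarith) h1 hδ hδ1
  · have := I.extP_of_not_above hn he h
    rw [hsymm]
    have := one_sub_le_atcVal (x := 1 - extP I.p i e) hε hε1 (by linarith) (by linarith) hδ hδ1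
    linarith

/-- The list is sorted, with its most preferred item first. -/
def Instance.Sorted (S : List (Fin n)) : Prop :=
  S.Pairwise fun a b => I.pos (.item a) < I.pos (.item b)

theorem Instance.sorted_trueRanking : I.Sorted I.trueRanking := by
  rw [Instance.Sorted, Instance.trueRanking, List.pairwise_ofFn]
  intro a b h
  simpa [Instance.pos] using h

theorem Instance.eq_trueRanking {S : List (Fin n)} (h : I.Sorted S)
    (hp : S.Perm (List.finRange n)) : S = I.trueRanking := by
  have : S.Perm I.trueRanking := by
    refine hp.trans ?_
    rw [List.perm_ext_iff_of_nodup (List.nodup_finRange n)]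
    · intro a
      simp only [List.mem_finRange, true_iff]
      rw [Instance.trueRanking, List.mem_ofFn]
      exact ⟨I.rank.symm a, by simp⟩
    · rw [Instance.trueRanking, List.nodup_ofFn]
      exact I.rank.injective
  exact this.eq_of_pairwise (fun a b _ _ h1 h2 => absurd h1 (not_lt.2 h2.le)) h I.sorted_trueRanking

theorem Instance.pairwise_endpoints {S : List (Fin n)} (h : I.Sorted S) :
    (endpoints S).Pairwise fun a b => I.pos b < I.pos a := by
  have hlt : ∀ j : Fin n, I.pos (.item j) < n := fun j => by
    simp only [Instance.pos]
    exact_mod_cast (I.rank.symm j).2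
  have hge : ∀ j : Fin n, -1 < I.pos (.item j) := fun j => by
    simp only [Instance.pos]
    omega
  rw [endpoints, List.pairwise_cons, List.pairwise_append]
  refine ⟨?_, ?_, List.pairwise_singleton _ _, ?_⟩
  · intro e he
    rcases List.mem_append.1 he with he | he
    · obtain ⟨j, -, rfl⟩ := List.mem_map.1 he
      exact hlt j
    · rw [List.mem_singleton.1 he]
      simp only [Instance.pos]
      omega
  · rw [List.pairwise_map, List.pairwise_reverse]
    exact h
  · intro e he f hf
    obtain ⟨j, -, rfl⟩ := List.mem_map.1 he
    rw [List.mem_singleton.1 hf]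
    exact hge j

end Instances

/-! ### Inserting an item into a sorted list -/

theorem mem_zip_tail_of_pairwise {α : Type*} {Q : α → α → Prop} {l : List α} (h : l.Pairwise Q)
    {a b : α} (hab : (a, b) ∈ l.zip l.tail) :
    Q a b ∧ ∀ c ∈ l, c = a ∨ c = b ∨ Q c a ∨ Q b c := by
  induction l with
  | nil => simp at hab
  | cons x l ih =>
    rcases l with _ | ⟨y, l⟩
    · simp at hab
    · rw [List.pairwise_cons] at h
      rw [List.tail_cons, List.zip_cons_cons, List.mem_cons] at hab
      rcases hab with hab | hab
      · obtain ⟨rfl, rfl⟩ := Prod.mk.inj hab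
        refine ⟨h.1 b (by simp), fun c hc => ?_⟩
        rcases List.mem_cons.1 hc with rfl | hc
        · exact Or.inl rfl
        · rcases List.mem_cons.1 hc with rfl | hc
          · exact Or.inr (Or.inl rfl)
          · exact Or.inr (Or.inr (Or.inr ((List.pairwise_cons.1 h.2).1 c hc)))
      · obtain ⟨h1, h2⟩ := ih h.2 hab
        refine ⟨h1, fun c hc => ?_⟩
        rcases List.mem_cons.1 hc with rfl | hc
        · exact Or.inr (Or.inr (Or.inl (h.1 a (List.of_mem_zip hab).1)))
        · exact h2 c hc

section Insertion

variable {n : ℕ} (I : Instance n)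

theorem perm_insertAfter (i k : Fin n) (S : List (Fin n)) :
    (insertAfter i k S).Perm (i :: S) := by
  induction S with
  | nil => exact List.Perm.refl _
  | cons a S ih =>
    rw [insertAfter]
    split_ifs
    · exact List.Perm.swap i a S
    · exact (ih.cons a).trans (List.Perm.swap i a S)

theorem sorted_insertAfter {i k : Fin n} {S : List (Fin n)} (hS : I.Sorted S) (hk : k ∈ S)
    (hki : I.pos (.item k) < I.pos (.item i))
    (h : ∀ j ∈ S, I.pos (.item k) < I.pos (.item j) → I.pos (.item i) < I.pos (.item j)) :
    I.Sorted (insertAfter i k S) := by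
  induction S with
  | nil => simp at hk
  | cons a S ih =>
    obtain ⟨ha, hS'⟩ := List.pairwise_cons.1 hS
    rw [insertAfter]
    split_ifs with hak
    · subst hak
      refine List.pairwise_cons.2 ⟨fun x hx => ?_, List.pairwise_cons.2 ⟨fun x hx => ?_, hS'⟩⟩
      · rcases List.mem_cons.1 hx with rfl | hx
        · exact hki
        · exact ha x hx
      · exact h x (List.mem_cons_of_mem _ hx) (ha x hx)
    · have hkS : k ∈ S := (List.mem_cons.1 hk).resolve_left fun h => hak h.symm
      refine List.pairwise_cons.2 ⟨fun x hx => ?_,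
        ih hS' hkS fun j hj => h j (List.mem_cons_of_mem _ hj)⟩
      rcases List.mem_cons.1 ((perm_insertAfter i k S).mem_iff.1 hx) with rfl | hx
      · exact (ha k hkS).trans hki
      · exact ha x hx

/-- `S'` arises from `S` by a correct insertion of `i`. -/
def Instance.Inserted (i : Fin n) (S S' : List (Fin n)) : Prop :=
  I.Sorted S' ∧ S'.Perm (i :: S)

theorem mem_endpoints {S : List (Fin n)} {j : Fin n} :
    ExtItem.item j ∈ endpoints S ↔ j ∈ S := by
  simp [endpoints]

/-- The interval joins neighbouring endpoints, so every listed item below r is the left end l or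
lies below it. As i is above l, placing i directly under r keeps the order. -/
theorem inserted_insertBelow {i : Fin n} {S : List (Fin n)} (hS : I.Sorted S)
    {l r : ExtItem n} (hlr : (l, r) ∈ (endpoints S).zip (endpoints S).tail)
    (hl : I.above i l = true) (hr : I.above i r = false) (hri : r ≠ .item i) :
    I.Inserted i S (insertBelow i r S) := by
  obtain ⟨-, h⟩ := mem_zip_tail_of_pairwise (I.pairwise_endpoints hS) hlr
  have hl' : I.pos (.item i) < I.pos l := by simpa [Instance.above] using hl
  have hr' : ¬ I.pos (.item i) < I.pos r := by simpa [Instance.above] using hr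
  have key : ∀ j ∈ S, I.pos r < I.pos (.item j) → I.pos (.item i) < I.pos (.item j) := by
    intro j hj hrj
    rcases h (.item j) (mem_endpoints.2 hj) with h | h | h | h
    · rwa [h]
    · rw [h] at hrj
      exact absurd hrj (lt_irrefl _)
    · exact hl'.trans h
    · exact absurd hrj (not_lt.2 h.le)
  rcases r with _ | k | _
  · exact absurd (by
      simp only [Instance.pos]
      exact_mod_cast (I.rank.symm i).2) hr'
  · have hk : k ∈ S := by
      have := (List.of_mem_zip hlr).2
      exact mem_endpoints.1 (List.mem_of_mem_tail this)
    have hki : k ≠ i := fun h => hri (by rw [h])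
    exact ⟨sorted_insertAfter I hS hk ((I.pos_lt_or_lt hki).resolve_left hr') key,
      perm_insertAfter i k S⟩
  · refine ⟨List.pairwise_cons.2 ⟨fun x hx => key x hx ?_, hS⟩, List.Perm.refl _⟩
    simp only [Instance.pos]
    omega

end Insertion

/-! ### The descent to the correct leaf in an interval tree -/

namespace PIT

variable {n : ℕ} (P : ExtItem n → Prop) (w : ExtItem n → Bool)

/-- The endpoints occurring in the tree satisfy `P`, `w` is monotone along the intervals, and the
intervals of children split those of their parents. -/
def Compatible : PIT n → Prop
  | leaf l r => P l ∧ P r ∧ (w r = true → w l = true)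
  | node l r m L R => P l ∧ P r ∧ P m ∧ (w r = true → w m = true) ∧ (w m = true → w l = true) ∧
      L.left = l ∧ L.right = m ∧ R.left = m ∧ R.right = r ∧ L.Compatible ∧ R.Compatible

variable {P w}

theorem Compatible.left {T : PIT n} (h : T.Compatible P w) : P T.left := by
  cases T <;> exact h.1

theorem Compatible.right {T : PIT n} (h : T.Compatible P w) : P T.right := by
  cases T <;> exact h.2.1

theorem Compatible.mono {T : PIT n} (h : T.Compatible P w) :
    w T.right = true → w T.left = true := by
  cases T with
  | leaf l r => exact h.2.2
  | node l r m L R => exact fun h' => h.2.2.2.2.1 (h.2.2.2.1 h')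

/-- Checking the leaves is enough: every endpoint of an inner node recurs at a leaf below it, and
monotonicity of w passes upwards through `mid`. -/
theorem compatible_of_splits {T : PIT n} (hT : T.Splits)
    (h : ∀ ab ∈ T.leafIntervals, P ab.1 ∧ P ab.2 ∧ (w ab.2 = true → w ab.1 = true)) :
    T.Compatible P w := by
  induction T with
  | leaf l r => exact h (l, r) (by simp [leafIntervals])
  | node l r m L R ihL ihR =>
    obtain ⟨h1, h2, h3, h4, h5, h6⟩ := hT
    have hL := ihL h5 fun ab hab => h ab (List.mem_append_left _ hab)
    have hR := ihR h6 fun ab hab => h ab (List.mem_append_right _ hab)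
    refine ⟨h1 ▸ hL.left, h2 ▸ hR.right, h3 ▸ hL.right, ?_, ?_, h1, h3, h4, h2, hL, hR⟩
    · have := hR.mono
      rwa [h2, h4] at this
    · have := hL.mono
      rwa [h1, h3] at this

theorem Compatible.child {T : PIT n} (h : T.Compatible P w) (b : Bool) :
    (T.child b).Compatible P w := by
  cases T with
  | leaf l r => exact h
  | node l r m L R =>
    cases b
    · exact h.2.2.2.2.2.2.2.2.2.1
    · exact h.2.2.2.2.2.2.2.2.2.2

theorem Compatible.subtree {T : PIT n} (h : T.Compatible P w) (X : List Bool) :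
    (T.subtree X).Compatible P w := by
  induction X with
  | nil => exact h
  | cons b X ih => exact ih.child b

variable (w)

/-- The address of the leaf at the end of the descent that turns right iff `w mid = true`. -/
def path : PIT n → List Bool → List Bool
  | leaf _ _, X => X
  | node _ _ m L R, X => if w m = true then R.path (true :: X) else L.path (false :: X)

theorem suffix_path (T : PIT n) (X : List Bool) : X <:+ T.path w X := by
  induction T generalizing X with
  | leaf l r => exact List.suffix_refl _
  | node l r m L R ihL ihR =>
    rw [path]
    split_ifs
    · exact (List.suffix_cons _ _).trans (ihR _)
    · exact (List.suffix_cons _ _).trans (ihL _)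

theorem length_path_lt (T : PIT n) (X : List Bool) :
    (T.path w X).length < X.length + T.depth := by
  induction T generalizing X with
  | leaf l r => simp [path, depth]
  | node l r m L R ihL ihR =>
    rw [path, depth]
    split_ifs
    · have := ihR (true :: X)
      rw [List.length_cons] at this
      omega
    · have := ihL (false :: X)
      rw [List.length_cons] at this
      omega

theorem path_mem_leafAddresses (T : PIT n) (X : List Bool) : T.path w X ∈ T.leafAddresses X := by
  induction T generalizing X with
  | leaf l r => simp [path, leafAddresses]
  | node l r m L R ihL ihR =>
    rw [path, leafAddresses, List.mem_append]
    split_ifs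
    · exact Or.inr (ihR _)
    · exact Or.inl (ihL _)

theorem path_eq_path_child {T : PIT n} {l r m : ExtItem n} {L R : PIT n}
    (h : T = node l r m L R) (X : List Bool) :
    T.path w X = (T.child (w m)).path w (w m :: X) := by
  subst h
  rw [path]
  cases hm : w m <;> simp [child]

/-- The tree is not a leaf. -/
def IsNode : PIT n → Prop
  | leaf _ _ => False
  | node _ _ _ _ _ => True

/-- The address leads to a node of the tree. -/
def ValidAddress (T : PIT n) : List Bool → Prop
  | [] => True
  | _ :: X => T.ValidAddress X ∧ (T.subtree X).IsNode

theorem ValidAddress.tail {T : PIT n} {X : List Bool} (h : T.ValidAddress X) :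
    T.ValidAddress X.tail := by
  cases X with
  | nil => exact h
  | cons b X => exact h.1

variable {w}

theorem eq_of_cons_suffix {α : Type*} {a b : α} {X Y : List α} (ha : (a :: X) <:+ Y)
    (hb : (b :: X) <:+ Y) : a = b := by
  have := List.suffix_of_suffix_length_le ha hb (by simp)
  have := this.eq_of_length (by simp)
  exact (List.cons.inj this).1

/-- Since addresses list the last step first, ancestors of the correct leaf are the suffixes of its
address. On the descent path both endpoint tests have the expected true answers. Once a step leaves
the path one of them has the opposite answer, and monotonicity of w preserves this further down. -/
theorem subtree_spec {T : PIT n} (hT : T.Compatible P w) (hl : w T.left = true)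
    (hr : w T.right = false) {X : List Bool} (hX : T.ValidAddress X) :
    (X <:+ T.path w [] → w (T.subtree X).left = true ∧ w (T.subtree X).right = false ∧
      T.path w [] = (T.subtree X).path w X) ∧
    (¬ X <:+ T.path w [] → w (T.subtree X).left = false ∨ w (T.subtree X).right = true) := by
  induction X with
  | nil => exact ⟨fun _ => ⟨hl, hr, rfl⟩, fun h => absurd (List.nil_suffix) h⟩
  | cons b X ih =>
    obtain ⟨hX, hnode⟩ := hX
    obtain ⟨ih1, ih2⟩ := ih hX
    have hc := hT.subtree X
    rcases hS : T.subtree X with ⟨l, r⟩ | ⟨l, r, m, L, R⟩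
    · rw [hS] at hnode
      exact hnode.elim
    · rw [hS] at hc ih1 ih2
      obtain ⟨-, -, -, hrm, hml, hLl, hLr, hRl, hRr, -, -⟩ := hc
      simp only [left, right] at ih1 ih2
      have hsub : T.subtree (b :: X) = if b then R else L := by
        rw [subtree, hS]
        cases b <;> rfl
      have hpath : X <:+ T.path w [] →
          T.path w [] = (if w m then R else L).path w (w m :: X) := by
        intro h
        rw [(ih1 h).2.2, path_eq_path_child w rfl]
        cases w m <;> rfl
      constructor
      · intro h
        have hXs : X <:+ T.path w [] := (List.suffix_cons b X).trans h
        have hb : b = w m := by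
          refine eq_of_cons_suffix h ?_
          rw [hpath hXs]
          exact suffix_path _ _ _
        obtain ⟨h1, h2, -⟩ := ih1 hXs
        rw [hsub]
        refine ⟨?_, ?_, ?_⟩
        · cases b
          · simpa [hLl] using h1
          · simpa [hRl] using hb.symm
        · cases b
          · simpa [hLr] using hb.symm
          · simpa [hRr] using h2
        · rw [hpath hXs, hb]
      · intro h
        rw [hsub]
        by_cases hXs : X <:+ T.path w []
        · have hb : b ≠ w m := by
            rintro rfl
            apply h
            rw [hpath hXs]
            exact suffix_path _ _ _
          cases b
          · right
            simpa [hLr] using hb.symm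
          · left
            simpa [hRl] using hb.symm
        · rcases ih2 hXs with h1 | h1
          · left
            cases b
            · simpa [hLl] using h1
            · have : w m = false := by
                by_contra hm
                rw [hml (by simpa using hm)] at h1
                exact Bool.noConfusion h1
              simpa [hRl] using this
          · right
            cases b
            · simpa [hLr] using hrm h1
            · simpa [hRr] using h1

end PIT

/-! ### The potential of Attempting-Insertion -/

/-- The distance of the nodes with addresses `X` and `Y` in a tree. -/
def addrDist (Y : List Bool) : List Bool → ℕ
  | [] => Y.length
  | b :: X => if (b :: X) <:+ Y then Y.length - (X.length + 1) else addrDist Y X + 1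

theorem addrDist_add_length {X Y : List Bool} (h : X <:+ Y) :
    addrDist Y X + X.length = Y.length := by
  have := h.length_le
  cases X with
  | nil => simp [addrDist]
  | cons b X =>
    rw [addrDist, if_pos h]
    rw [List.length_cons] at *
    omega

theorem addrDist_cons_of_not_suffix {b : Bool} {X Y : List Bool} (h : ¬ (b :: X) <:+ Y) :
    addrDist Y (b :: X) = addrDist Y X + 1 := by
  rw [addrDist, if_neg h]

theorem addrDist_cons_of_suffix {b : Bool} {X Y : List Bool} (h : (b :: X) <:+ Y) :
    addrDist Y (b :: X) + 1 = addrDist Y X := by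
  have h1 := addrDist_add_length h
  have h2 := addrDist_add_length ((List.suffix_cons b X).trans h)
  rw [List.length_cons] at h1
  omega

theorem addrDist_self (Y : List Bool) : addrDist Y Y = 0 := by
  have := addrDist_add_length (List.suffix_refl Y)
  omega

section

variable {n : ℕ}

theorem PIT.leafIntervals_child_subset (T : PIT n) (b : Bool) :
    (T.child b).leafIntervals ⊆ T.leafIntervals := by
  cases T with
  | leaf l r => exact fun _ h => h
  | node l r m L R =>
    cases b
    · exact List.subset_append_left _ _
    · exact List.subset_append_right _ _

theorem PIT.leafIntervals_subtree_subset (T : PIT n) (X : List Bool) :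
    (T.subtree X).leafIntervals ⊆ T.leafIntervals := by
  induction X with
  | nil => exact fun _ h => h
  | cons b X ih => exact fun x h => ih (PIT.leafIntervals_child_subset _ b h)

/-- The properties of a preference interval tree of `S` that matter for the insertion of `i`. -/
structure InsertionTree (I : Instance n) (i : Fin n) (S : List (Fin n)) (T : PIT n) : Prop where
  compatible : T.Compatible (fun e => e ≠ .item i) (I.above i)
  above_left : I.above i T.left = true
  above_right : I.above i T.right = false
  isNode : T.IsNode
  inserted : ∀ X l r, T.subtree X = .leaf l r → I.above i l = true → I.above i r = false →
    I.Inserted i S (insertBelow i r S)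

/-- Nonemptiness of S makes the root an inner node. A root that is a leaf would be its own parent,
as `[].tail = []`, and the distance could not change by one. -/
theorem IsPIT.insertionTree {I : Instance n} {i : Fin n} {S : List (Fin n)} {T : PIT n}
    (hT : IsPIT S T) (hS : I.Sorted S) (hne : S ≠ []) (hi : i ∉ S) : InsertionTree I i S T := by
  obtain ⟨hd, hl, hr, hint, hsp⟩ := hT
  have hends : ∀ e ∈ endpoints S, e ≠ .item i := by
    rintro e he rfl
    exact hi (mem_endpoints.1 he)
  have hcomp : T.Compatible (fun e => e ≠ .item i) (I.above i) := by
    refine PIT.compatible_of_splits hsp fun ab hab => ?_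
    obtain ⟨a, b⟩ := ab
    rw [hint] at hab
    obtain ⟨h1, h2⟩ := List.of_mem_zip hab
    refine ⟨hends a h1, hends b (List.mem_of_mem_tail h2), ?_⟩
    have h3 := (mem_zip_tail_of_pairwise (I.pairwise_endpoints hS) hab).1
    simp only [Instance.above, decide_eq_true_eq]
    exact fun h => h.trans h3
  refine ⟨hcomp, ?_, ?_, ?_, fun X l r h h1 h2 => ?_⟩
  · rw [hl]
    simp [Instance.above, Instance.pos]
  · rw [hr]
    exact decide_eq_false (by simp only [Instance.pos]; omega)
  · cases T with
    | leaf l r =>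
      have h1 := congrArg List.length hint
      have h2 := List.length_pos_of_ne_nil hne
      simp [PIT.leafIntervals, endpoints] at h1
      exact absurd h1 hne
    | node => trivial
  · have hmem : (l, r) ∈ (endpoints S).zip (endpoints S).tail := by
      rw [← hint]
      apply PIT.leafIntervals_subtree_subset T X
      rw [h]
      simp [PIT.leafIntervals]
    exact inserted_insertBelow I hS hmem h1 h2 (hends r (List.mem_of_mem_tail
      (List.of_mem_zip hmem).2))

/-- The potential of the state of Attempting-Insertion in which the moving point is at `X` with
counter `a`, where `Y` is the address of the correct leaf. -/
def potential (Y X : List Bool) (a : ℕ) : ℤ := if X = Y then -a else addrDist Y X + a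

/-- The counter, if it belongs to a wrong leaf. -/
def wrongCount (Y X : List Bool) (a : ℕ) : ℕ := if X = Y then 0 else a

theorem potential_zero (Y X : List Bool) : potential Y X 0 = addrDist Y X := by
  unfold potential
  split_ifs with h
  · rw [h, addrDist_self]
    simp
  · simp

theorem wrongCount_zero (Y X : List Bool) : wrongCount Y X 0 = 0 := by
  simp [wrongCount]

theorem fifteen_le_sqrt_atiQ : 15 / 16 ≤ Real.sqrt atiQ ∧ Real.sqrt atiQ < 1 ∧
    Real.sqrt atiQ * Real.sqrt atiQ = 15 / 16 := by
  have h0 : (0 : ℝ) ≤ atiQ := by norm_num [atiQ]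
  refine ⟨Real.le_sqrt_of_sq_le (by norm_num [atiQ]), ?_, Real.mul_self_sqrt h0⟩
  rw [Real.sqrt_lt' one_pos]
  norm_num [atiQ]

theorem fifteen_le_cbrt_atiQ : 15 / 16 ≤ atiQ ^ (1 / 3 : ℝ) ∧ atiQ ^ (1 / 3 : ℝ) < 1 ∧
    atiQ ^ (1 / 3 : ℝ) * atiQ ^ (1 / 3 : ℝ) * atiQ ^ (1 / 3 : ℝ) = 15 / 16 := by
  have h0 : (0 : ℝ) < atiQ := by norm_num [atiQ]
  have h1 : atiQ < 1 := by norm_num [atiQ]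
  refine ⟨?_, Real.rpow_lt_one h0.le h1 (by norm_num), ?_⟩
  · have := Real.rpow_le_rpow_of_exponent_ge h0 h1.le (by norm_num : (1 / 3 : ℝ) ≤ 1)
    rwa [Real.rpow_one] at this
  · rw [← Real.rpow_add h0, ← Real.rpow_add h0]
    norm_num [atiQ]

end

/-! ### One round of Attempting-Insertion as a step of the potential -/

section

variable {n : ℕ} {I : Instance n} {i : Fin n} {S : List (Fin n)} {T : PIT n} {F : ℕ}
  {g : Option (Option (List (Fin n))) → ENNReal} {Ψ : ℕ → ℕ → ℤ → ℕ → ℝ} {ε δ η : ℝ}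

/-- Only the counter at X can be nonzero, so a leaf that reaches the final threshold is X itself. An
unsure result means in particular that the correct counter is below the threshold, which bounds the
potential from below. -/
theorem val_atiLoop_zero_le (hT : InsertionTree I i S T)
    (hg1 : ∀ v, g v ≤ 1) (hg : ∀ S', I.Inserted i S S' → g (some (some S')) = 0)
    (hleaf : ∀ t φ (m : ℕ), (m : ℤ) ≤ φ → 1 + 5 / 16 * (atiRounds S.length δ : ℝ) ≤ m → 1 ≤ Ψ 0 t φ m)
    (hunsure : ∀ t (φ : ℤ) (m : ℕ), -(1 + 5 / 16 * (atiRounds S.length δ : ℝ)) < φ →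
      g (some none) ≤ ENNReal.ofReal (Ψ 0 t φ m))
    (t : ℕ) {X : List Bool} {c : List Bool → ℕ} (hX : T.ValidAddress X)
    (hc : ∀ v, v ≠ X → c v = 0) (hcX : 0 < c X → ¬ (T.subtree X).IsNode) :
    val I.p F (atiLoop T i S ε δ 0 t X c) g ≤ ENNReal.ofReal
      (Ψ 0 t (potential (T.path (I.above i) []) X (c X))
        (wrongCount (T.path (I.above i) []) X (c X))) := by
  set Y := T.path (I.above i) [] with hY
  have hR : (0 : ℝ) ≤ atiRounds S.length δ := Nat.cast_nonneg _
  rw [atiLoop, val_pure]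
  rcases hfind : (T.leafAddresses []).find? (fun u =>
      decide ((c u : ℝ) ≥ 1 + 5 / 16 * atiRounds S.length δ)) with _ | u
  · rw [Option.map_none]
    apply hunsure
    unfold potential
    split_ifs with hXY
    · rw [List.find?_eq_none] at hfind
      have := hfind Y (PIT.path_mem_leafAddresses _ _ _)
      rw [decide_eq_true_eq, not_le, ← hXY] at this
      push_cast
      linarith
    · push_cast
      have h1 : (0 : ℝ) ≤ c X := Nat.cast_nonneg _
      have h2 : (0 : ℝ) ≤ addrDist Y X := Nat.cast_nonneg _
      linarith
  · have hu := List.find?_some hfind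
    rw [decide_eq_true_eq] at hu
    have hu0 : 0 < c u := by
      have : (0 : ℝ) < c u := by linarith
      exact_mod_cast this
    have huX : u = X := by
      by_contra h
      rw [hc u h] at hu0
      omega
    subst huX
    rw [Option.map_some]
    by_cases huY : u = Y
    · have hspec := (PIT.subtree_spec hT.compatible hT.above_left hT.above_right hX).1
        (by rw [huY])
      have hnot := hcX hu0
      rcases hS : T.subtree u with ⟨l, r⟩ | ⟨l, r, m, L, R⟩
      · rw [hS] at hspec
        rw [PIT.right, hg _ (hT.inserted u l r hS hspec.1 hspec.2.1)]
        exact zero_le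
      · rw [hS] at hnot
        exact absurd trivial hnot
    · refine (hg1 _).trans ?_
      rw [ENNReal.one_le_ofReal]
      apply hleaf
      · rw [potential, wrongCount, if_neg huY, if_neg huY]
        omega
      · rw [wrongCount, if_neg huY]
        exact hu

/-- The comparison principle: a supersolution Ψ(rounds left, round, potential, wrong counter)
dominates the expectation of any failure indicator g. The form of `hη` serves η = 1 without a gap
assumption and η = 1/16 when ε ≤ Δ_i. The bound `c X + 1 ≤ t` records that a counter cannot exceed
the number of completed rounds. -/
theorem val_atiLoop_le (hn : 2 ≤ n) (hT : InsertionTree I i S T) (hε : 0 < ε) (hε1 : ε < 1 / 2)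
    (hη : ∀ u : ℝ, u ≤ 1 → (ε ≤ I.gap i → u ≤ 1 / 16) → u ≤ η)
    (hg1 : ∀ v, g v ≤ 1) (hg : ∀ S', I.Inserted i S S' → g (some (some S')) = 0)
    (hΨ : ∀ k t φ m, 0 ≤ Ψ k t φ m)
    (hleaf : ∀ t φ (m : ℕ), (m : ℤ) ≤ φ → 1 + 5 / 16 * (atiRounds S.length δ : ℝ) ≤ m → 1 ≤ Ψ 0 t φ m)
    (hunsure : ∀ t (φ : ℤ) (m : ℕ), -(1 + 5 / 16 * (atiRounds S.length δ : ℝ)) < φ →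
      g (some none) ≤ ENNReal.ofReal (Ψ 0 t φ m))
    (hstep : ∀ k t φ u, 0 ≤ u → u ≤ η →
      (1 - u) * Ψ k (t + 1) (φ - 1) 0 + u * Ψ k (t + 1) (φ + 1) 0 ≤ Ψ (k + 1) t φ 0)
    (hstep_wrong : ∀ k t φ m u, 0 ≤ u → u ≤ η → u ≤ 1 / 2 → m + 1 ≤ t →
      (1 - u) * Ψ k (t + 1) (φ - 1) (m - 1) +
        u * (if ((m + 1 : ℕ) : ℝ) > atiThreshold δ t then 1 else Ψ k (t + 1) (φ + 1) (m + 1)) ≤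
        Ψ (k + 1) t φ m)
    (k t : ℕ) {X : List Bool} {c : List Bool → ℕ} (hX : T.ValidAddress X)
    (hc : ∀ v, v ≠ X → c v = 0) (hcX : 0 < c X → ¬ (T.subtree X).IsNode) (hct : c X + 1 ≤ t) :
    val I.p F (atiLoop T i S ε δ k t X c) g ≤ ENNReal.ofReal
      (Ψ k t (potential (T.path (I.above i) []) X (c X))
        (wrongCount (T.path (I.above i) []) X (c X))) := by
  induction k generalizing t X c with
  | zero => exact val_atiLoop_zero_le hT hg1 hg hleaf hunsure t hX hc hcX
  | succ k ih =>
    set Y := T.path (I.above i) [] with hY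
    have hcomp := hT.compatible.subtree X
    obtain ⟨hon, hoff⟩ := PIT.subtree_spec hT.compatible hT.above_left hT.above_right hX
    rw [← hY] at hon hoff
    have hzero : (∀ v, c v = 0) → ∀ X' : List Bool, T.ValidAddress X' →
        val I.p F (atiLoop T i S ε δ k (t + 1) X' c) g ≤
          ENNReal.ofReal (Ψ k (t + 1) (addrDist Y X') 0) := by
      intro hc0 X' hX'
      have := ih (t + 1) hX' (fun v _ => hc0 v) (fun h => absurd h (by rw [hc0]; omega))
        (by rw [hc0]; omega)
      rwa [hc0, potential_zero, wrongCount_zero] at this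
    rcases hS : T.subtree X with ⟨l, r⟩ | ⟨l, r, m, L, R⟩
    · rw [hS] at hcomp hon hoff
      simp only [PIT.left, PIT.right, PIT.path] at hon hoff
      have hXne : X ≠ [] := by
        rintro rfl
        have := hT.isNode
        rw [show T = T.subtree [] from rfl, hS] at this
        exact this
      obtain ⟨b0, X0, rfl⟩ := List.exists_cons_of_ne_nil hXne
      obtain ⟨s1, s2, s3⟩ := fifteen_le_sqrt_atiQ
      obtain ⟨θa, hA, ha1, ha2, ha3⟩ := exists_isBern_atc (I := I) (F := F) hn hcomp.1 hε hε1
        (sub_pos.2 s2) (by linarith)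
      obtain ⟨θb, hB, hb1, hb2, hb3⟩ := exists_isBern_atc (I := I) (F := F) hn hcomp.2.1 hε hε1
        (sub_pos.2 s2) (by linarith)
      have hA0 := hA.nonneg
      have hA1 := hA.le_one
      have hB0 := hB.nonneg
      have hB1 := hB.le_one
      set X := b0 :: X0 with hXdef
      have hupd : ∀ a : ℕ, a ≤ t → val I.p F (atiLoop T i S ε δ k (t + 1) X
          (Function.update c X a)) g ≤
          ENNReal.ofReal (Ψ k (t + 1) (potential Y X a) (wrongCount Y X a)) := by
        intro a ha
        have := ih (t + 1) (X := X) (c := Function.update c X a) hX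
          (fun v hv => by rw [Function.update_of_ne hv, hc v hv])
          (fun _ => by rw [hS]; exact fun h => h) (by rw [Function.update_self]; omega)
        rwa [Function.update_self] at this
      have htail : c X = 0 → val I.p F (atiLoop T i S ε δ k (t + 1) X.tail c) g ≤
          ENNReal.ofReal (Ψ k (t + 1) (addrDist Y X.tail) 0) := by
        intro h0
        refine hzero (fun v => ?_) _ hX.tail
        by_cases hv : v = X
        · rw [hv, h0]
        · exact hc v hv
      have hcomb : ∀ N D : ℝ, 0 ≤ N → 0 ≤ D →
          val I.p F (if (Function.update c X (c X + 1) X : ℝ) > atiThreshold δ t then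
            pure (some (insertBelow i r S))
            else atiLoop T i S ε δ k (t + 1) X (Function.update c X (c X + 1))) g ≤
            ENNReal.ofReal N →
          val I.p F (if c X > 0 then
            atiLoop T i S ε δ k (t + 1) X (Function.update c X (c X - 1))
            else atiLoop T i S ε δ k (t + 1) X.tail c) g ≤ ENNReal.ofReal D →
          val I.p F (atiLoop T i S ε δ (k + 1) t X c) g ≤
            ENNReal.ofReal (θa * (1 - θb) * N + (1 - θa * (1 - θb)) * D) := by
        intro N D hN hD h1 h2
        rw [atiLoop, hS]
        have e : θa * (1 - θb) * N + (1 - θa * (1 - θb)) * D =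
          θa * (θb * D + (1 - θb) * N) + (1 - θa) * (θb * D + (1 - θb) * D) := by ring
        rw [e]
        have hB1' := sub_nonneg.2 hB1
        refine hA.val_bind_le (by positivity) (by positivity)
          (hB.val_bind_le hD hN ?_ ?_) (hB.val_bind_le hD hD ?_ ?_)
        · simpa using h2
        · simpa using h1
        · simpa using h2
        · simpa using h2
      -- At the correct leaf success of both tests lowers the potential, possibly by an insertion,
      -- for which g = 0. Failure raises it, by decreasing the counter or by leaving the leaf.
      by_cases hXY : X = Y
      · obtain ⟨hl, hr, -⟩ := hon (by rw [hXY])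
        have hpot : ∀ a : ℕ, potential Y X a = -a := fun a => by rw [potential, if_pos hXY]
        have hwc : ∀ a : ℕ, wrongCount Y X a = 0 := fun a => by rw [wrongCount, if_pos hXY]
        rw [hpot, hwc]
        refine (hcomb (Ψ k (t + 1) (-(c X : ℤ) - 1) 0) (Ψ k (t + 1) (-(c X : ℤ) + 1) 0)
          (hΨ _ _ _ _) (hΨ _ _ _ _) ?_ ?_).trans (ENNReal.ofReal_le_ofReal ?_)
        · split_ifs
          · rw [val_pure, hg _ (hT.inserted X l r hS hl hr)]
            exact zero_le
          · have := hupd (c X + 1) hct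
            rw [hpot, hwc] at this
            convert this using 3
            push_cast
            ring
        · split_ifs with h0
          · have := hupd (c X - 1) (by omega)
            rw [hpot, hwc] at this
            convert this using 3
            omega
          · have h0' : c X = 0 := by omega
            have h1 := htail h0'
            have h2 : addrDist Y X.tail = 1 := by
              have := addrDist_cons_of_suffix (b := b0) (X := X0) (Y := Y) (by rw [← hXY])
              rw [← hXdef, hXY, addrDist_self] at this
              exact this.symm
            rw [h2] at h1
            rw [h0']
            exact h1
        · have := hstep k t (-(c X : ℤ)) (1 - θa * (1 - θb)) (by nlinarith) (hη _ (by nlinarith)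
            fun h => by
              have q1 := (ha3 h).1 hl
              have q2 := (hb3 h).2 hr
              nlinarith)
          linarith
      · have hns : ¬ X <:+ Y := fun h => hXY (hon h).2.2.symm
        have hpot : ∀ a : ℕ, potential Y X a = addrDist Y X + a := fun a => by
          rw [potential, if_neg hXY]
        have hwc : ∀ a : ℕ, wrongCount Y X a = a := fun a => by rw [wrongCount, if_neg hXY]
        rw [hpot, hwc]
        refine (hcomb (if ((c X + 1 : ℕ) : ℝ) > atiThreshold δ t then 1 else
            Ψ k (t + 1) (addrDist Y X + c X + 1) (c X + 1))
          (Ψ k (t + 1) (addrDist Y X + c X - 1) (c X - 1))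
          (by split_ifs; exacts [zero_le_one, hΨ _ _ _ _]) (hΨ _ _ _ _) ?_ ?_).trans
          (ENNReal.ofReal_le_ofReal ?_)
        · rw [Function.update_self]
          split_ifs
          · rw [ENNReal.ofReal_one, val_pure]
            exact hg1 _
          · have := hupd (c X + 1) hct
            rw [hpot, hwc] at this
            convert this using 3
            push_cast
            ring
        · split_ifs with h0
          · have := hupd (c X - 1) (by omega)
            rw [hpot, hwc] at this
            convert this using 3
            omega
          · have h0' : c X = 0 := by omega
            have h1 := htail h0'
            have h2 : addrDist Y X = addrDist Y X.tail + 1 := addrDist_cons_of_not_suffix hns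
            rw [h0', h2]
            convert h1 using 3
            push_cast
            ring
        · have hB1' := sub_nonneg.2 hB1
          -- One endpoint of a wrong leaf lies on the wrong side of i, so already that single test
          -- passes with probability at most 1/2, and at most 1 - √q ≤ 1/16 below the gap.
          have hu : θa * (1 - θb) ≤ 1 / 2 ∧ (ε ≤ I.gap i → θa * (1 - θb) ≤ 1 / 16) := by
            rcases hoff hns with h | h
            · refine ⟨by nlinarith [ha2 h], fun h' => ?_⟩
              have := (ha3 h').2 h
              nlinarith
            · refine ⟨by nlinarith [hb1 h], fun h' => ?_⟩
              have := (hb3 h').1 h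
              nlinarith
          have := hstep_wrong k t (addrDist Y X + c X) (c X) (θa * (1 - θb)) (by positivity)
            (hη _ (by linarith) hu.2) hu.1 hct
          linarith
    · rw [hS] at hcomp hon hoff hcX
      have hc0 : ∀ v, c v = 0 := by
        intro v
        by_cases hv : v = X
        · by_contra h0
          exact hcX (by rw [← hv]; omega) trivial
        · exact hc v hv
      obtain ⟨-, -, hm, -⟩ := id hcomp
      have hvalid : ∀ b, T.ValidAddress (b :: X) := fun b => ⟨hX, by rw [hS]; trivial⟩
      have hchild : X <:+ Y → (I.above i m :: X) <:+ Y := by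
        intro h
        rw [(hon h).2.2, PIT.path_eq_path_child _ rfl]
        exact PIT.suffix_path _ _ _
      rw [hc0, potential_zero, wrongCount_zero]
      have hgood : X <:+ Y → ∀ b, b = I.above i m →
          val I.p F (atiLoop T i S ε δ k (t + 1) (b :: X) c) g ≤
            ENNReal.ofReal (Ψ k (t + 1) (addrDist Y X - 1) 0) := by
        rintro h b rfl
        convert hzero hc0 _ (hvalid _) using 3
        have := addrDist_cons_of_suffix (hchild h)
        omega
      have hbad : ∀ b, (X <:+ Y → b ≠ I.above i m) →
          val I.p F (atiLoop T i S ε δ k (t + 1) (b :: X) c) g ≤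
            ENNReal.ofReal (Ψ k (t + 1) (addrDist Y X + 1) 0) := by
        intro b hb
        convert hzero hc0 _ (hvalid _) using 3
        rw [addrDist_cons_of_not_suffix]
        · push_cast
          rfl
        · intro h
          have hs := (List.suffix_cons b X).trans h
          exact hb hs (PIT.eq_of_cons_suffix h (hchild hs))
      by_cases hX0 : X = []
      · have hsuf : X <:+ Y := by
          rw [hX0]
          exact List.nil_suffix
        have hq : (1 : ℝ) - atiQ = 1 / 16 := by norm_num [atiQ]
        obtain ⟨θ, hA, ha1, ha2, ha3⟩ := exists_isBern_atc (I := I) (F := F) hn hm hε hε1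
          (δ := 1 - atiQ) (by rw [hq]; norm_num) (by rw [hq]; norm_num)
        rw [hq] at ha3
        have hA0 := hA.nonneg
        have hA1 := hA.le_one
        rw [atiLoop, hS]
        dsimp only
        rw [if_pos hX0]
        cases hw : I.above i m
        · refine (hA.val_bind_le (hΨ k (t + 1) (addrDist Y X + 1) 0)
            (hΨ k (t + 1) (addrDist Y X - 1) 0) ?_ ?_).trans (ENNReal.ofReal_le_ofReal ?_)
          · simpa using hbad true (by simp [hw])
          · simpa using hgood hsuf false hw.symm
          · have := hstep k t (addrDist Y X) θ hA0 (hη _ hA1 fun h => (ha3 h).2 hw)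
            linarith
        · refine (hA.val_bind_le (hΨ k (t + 1) (addrDist Y X - 1) 0)
            (hΨ k (t + 1) (addrDist Y X + 1) 0) ?_ ?_).trans (ENNReal.ofReal_le_ofReal ?_)
          · simpa using hgood hsuf true hw.symm
          · simpa using hbad false (by simp [hw])
          · have := hstep k t (addrDist Y X) (1 - θ) (by linarith) (hη _ (by linarith) fun h => by
              linarith [(ha3 h).1 hw])
            linarith
      · obtain ⟨b0, X0, rfl⟩ := List.exists_cons_of_ne_nil hX0
        set X := b0 :: X0 with hXdef
        obtain ⟨s1, s2, s3⟩ := fifteen_le_cbrt_atiQ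
        obtain ⟨θa, hA, ha1, ha2, ha3⟩ := exists_isBern_atc (I := I) (F := F) hn hcomp.1 hε hε1
          (sub_pos.2 s2) (by linarith)
        obtain ⟨θb, hB, hb1, hb2, hb3⟩ := exists_isBern_atc (I := I) (F := F) hn hcomp.2.1 hε hε1
          (sub_pos.2 s2) (by linarith)
        obtain ⟨θd, hD, hd1, hd2, hd3⟩ := exists_isBern_atc (I := I) (F := F) hn hm hε hε1
          (sub_pos.2 s2) (by linarith)
        have hA0 := hA.nonneg
        have hA1 := sub_nonneg.2 hA.le_one
        have hB0 := hB.nonneg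
        have hB1 := sub_nonneg.2 hB.le_one
        have hD0 := hD.nonneg
        have hD1 := sub_nonneg.2 hD.le_one
        have hcomb : ∀ U V W : ℝ, 0 ≤ U → 0 ≤ V → 0 ≤ W →
            val I.p F (atiLoop T i S ε δ k (t + 1) X.tail c) g ≤ ENNReal.ofReal U →
            val I.p F (atiLoop T i S ε δ k (t + 1) (true :: X) c) g ≤ ENNReal.ofReal V →
            val I.p F (atiLoop T i S ε δ k (t + 1) (false :: X) c) g ≤ ENNReal.ofReal W →
            val I.p F (atiLoop T i S ε δ (k + 1) t X c) g ≤ ENNReal.ofReal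
              (θa * (1 - θb) * (θd * V + (1 - θd) * W) + (1 - θa * (1 - θb)) * U) := by
          intro U V W hU hV hW h1 h2 h3
          rw [atiLoop, hS]
          dsimp only
          rw [if_neg hX0]
          have e : θa * (1 - θb) * (θd * V + (1 - θd) * W) + (1 - θa * (1 - θb)) * U =
            θa * (θb * U + (1 - θb) * (θd * V + (1 - θd) * W)) +
              (1 - θa) * (θb * U + (1 - θb) * U) := by ring
          rw [e]
          refine hA.val_bind_le (by positivity) (by positivity)
            (hB.val_bind_le hU (by positivity) ?_ ?_) (hB.val_bind_le hU hU ?_ ?_)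
          · simpa using h1
          · simpa using hD.val_bind_le (f := fun d => if d = true then
              atiLoop T i S ε δ k (t + 1) (true :: X) c
              else atiLoop T i S ε δ k (t + 1) (false :: X) c) hV hW (by simpa using h2)
              (by simpa using h3)
          · simpa using h1
          · simpa using h1
        -- On the path three right answers move X towards the correct leaf, with probability at
        -- least q below the gap. Off the path only the return to the parent helps, and a single
        -- right answer triggers it.
        by_cases hs : X <:+ Y
        · obtain ⟨hl, hr, -⟩ := hon hs
          have hpar : val I.p F (atiLoop T i S ε δ k (t + 1) X.tail c) g ≤
              ENNReal.ofReal (Ψ k (t + 1) (addrDist Y X + 1) 0) := by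
            convert hzero hc0 _ hX.tail using 3
            have := addrDist_cons_of_suffix hs
            rw [← hXdef] at this
            rw [hXdef, List.tail_cons, ← this]
            push_cast
            rfl
          have hab : 0 ≤ 1 - θa * (1 - θb) := by nlinarith
          cases hw : I.above i m
          · refine (hcomb _ _ _ (hΨ _ _ _ _) (hΨ _ _ _ _) (hΨ _ _ _ _) hpar
              (hbad true (by simp [hw])) (hgood hs false hw.symm)).trans
              (ENNReal.ofReal_le_ofReal ?_)
            have := hstep k t (addrDist Y X) (1 - θa * (1 - θb) * (1 - θd)) (by
              have : θa * (1 - θb) * (1 - θd) ≤ 1 * 1 := by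
                gcongr <;> linarith
              linarith) (hη _ (by
                have : 0 ≤ θa * (1 - θb) * (1 - θd) := by positivity
                linarith) fun h => by
              have q1 := (ha3 h).1 hl
              have q2 := (hb3 h).2 hr
              have q3 := (hd3 h).2 hw
              have : atiQ ^ (1 / 3 : ℝ) * atiQ ^ (1 / 3 : ℝ) * atiQ ^ (1 / 3 : ℝ) ≤
                  θa * (1 - θb) * (1 - θd) := by
                gcongr <;> linarith
              linarith)
            linarith
          · refine (hcomb _ _ _ (hΨ _ _ _ _) (hΨ _ _ _ _) (hΨ _ _ _ _) hpar
              (hgood hs true hw.symm) (hbad false (by simp [hw]))).trans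
              (ENNReal.ofReal_le_ofReal ?_)
            have := hstep k t (addrDist Y X) (1 - θa * (1 - θb) * θd) (by
              have : θa * (1 - θb) * θd ≤ 1 * 1 := by
                gcongr <;> linarith
              linarith) (hη _ (by
                have : 0 ≤ θa * (1 - θb) * θd := by positivity
                linarith) fun h => by
              have q1 := (ha3 h).1 hl
              have q2 := (hb3 h).2 hr
              have q3 := (hd3 h).1 hw
              have : atiQ ^ (1 / 3 : ℝ) * atiQ ^ (1 / 3 : ℝ) * atiQ ^ (1 / 3 : ℝ) ≤
                  θa * (1 - θb) * θd := by
                gcongr <;> linarith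
              linarith)
            linarith
        · have hpar : val I.p F (atiLoop T i S ε δ k (t + 1) X.tail c) g ≤
              ENNReal.ofReal (Ψ k (t + 1) (addrDist Y X - 1) 0) := by
            convert hzero hc0 _ hX.tail using 3
            rw [hXdef, addrDist_cons_of_not_suffix hs]
            push_cast
            rw [List.tail_cons]
            ring
          refine (hcomb _ _ _ (hΨ _ _ _ _) (hΨ _ _ _ _) (hΨ _ _ _ _) hpar
              (hbad true fun h => absurd h hs) (hbad false fun h => absurd h hs)).trans
              (ENNReal.ofReal_le_ofReal ?_)
          have hu : θa * (1 - θb) ≤ 1 ∧ (ε ≤ I.gap i → θa * (1 - θb) ≤ 1 / 16) := by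
            refine ⟨by nlinarith, fun h' => ?_⟩
            rcases hoff hs with h | h
            · have := (ha3 h').2 h
              nlinarith
            · have := (hb3 h').1 h
              nlinarith
          have := hstep k t (addrDist Y X) (θa * (1 - θb)) (by positivity) (hη _ hu.1 hu.2)
          linarith

end

/-! ### Exponential bounds for wrong insertions before the last round -/

/-- The parameter of the exponential bound for an insertion in round `s`. -/
noncomputable def atiTilt (δ : ℝ) (s : ℕ) : ℝ :=
  4 * Real.sqrt (s / 2 * Real.log (Real.pi ^ 2 * (s : ℝ) ^ 2 / (3 * δ))) / s

/-- The term of the exponential bound that belongs to a wrong insertion in round `s`. -/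
noncomputable def atiTerm (δ : ℝ) (s t m : ℕ) : ℝ :=
  Real.exp (atiTilt δ s * (m - atiThreshold δ s) +
    (atiTilt δ s / 2 + atiTilt δ s ^ 2 / 8) * (s + 1 - t))

theorem atiTilt_nonneg (δ : ℝ) (s : ℕ) : 0 ≤ atiTilt δ s := by
  unfold atiTilt
  positivity

theorem atiTerm_pos (δ : ℝ) (s t m : ℕ) : 0 < atiTerm δ s t m := Real.exp_pos _

theorem one_add_exp_div_two_le (a : ℝ) :
    (1 + Real.exp a) / 2 ≤ Real.exp (a / 2 + a ^ 2 / 8) := by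
  have h := Real.cosh_le_exp_half_sq (a / 2)
  rw [Real.cosh_eq] at h
  have h1 : Real.exp (a / 2) * Real.exp (a / 2) = Real.exp a := by
    rw [← Real.exp_add, add_halves]
  have h2 : Real.exp (a / 2) * Real.exp (-(a / 2)) = 1 := by
    rw [← Real.exp_add]
    simp
  calc (1 + Real.exp a) / 2 =
        Real.exp (a / 2) * ((Real.exp (a / 2) + Real.exp (-(a / 2))) / 2) := by
        rw [← h1, ← h2]
        ring
    _ ≤ Real.exp (a / 2) * Real.exp ((a / 2) ^ 2 / 2) := by gcongr
    _ = _ := by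
      rw [← Real.exp_add]
      congr 1
      ring

theorem atiTerm_succ_le (δ : ℝ) (s t m : ℕ) : atiTerm δ s (t + 1) m ≤ atiTerm δ s t m := by
  have := atiTilt_nonneg δ s
  unfold atiTerm
  apply Real.exp_le_exp.2
  push_cast
  nlinarith [sq_nonneg (atiTilt δ s)]

/-- Decrements are discarded, which bounds the counter by a count of successes of probability at
most 1/2. The moment of such a success, (1 + exp a)/2, explains the rate a/2 + a²/8. -/
theorem atiTerm_step {u : ℝ} (hu : u ≤ 1 / 2) (δ : ℝ) (s t m : ℕ) :
    (1 - u) * atiTerm δ s (t + 1) (m - 1) + u * atiTerm δ s (t + 1) (m + 1) ≤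
      atiTerm δ s t m := by
  have ha := atiTilt_nonneg δ s
  have h1 : atiTerm δ s (t + 1) (m - 1) ≤ atiTerm δ s (t + 1) m := by
    unfold atiTerm
    apply Real.exp_le_exp.2
    gcongr
    omega
  have h2 : atiTerm δ s (t + 1) (m + 1) = atiTerm δ s (t + 1) m * Real.exp (atiTilt δ s) := by
    unfold atiTerm
    rw [← Real.exp_add]
    congr 1
    push_cast
    ring
  have h3 : atiTerm δ s t m = atiTerm δ s (t + 1) m *
      Real.exp (atiTilt δ s / 2 + atiTilt δ s ^ 2 / 8) := by
    unfold atiTerm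
    rw [← Real.exp_add]
    congr 1
    push_cast
    ring
  have h4 := one_add_exp_div_two_le (atiTilt δ s)
  have h5 : 1 ≤ Real.exp (atiTilt δ s) := Real.one_le_exp ha
  have h6 := atiTerm_pos δ s (t + 1) m
  rw [h2, h3]
  calc _ ≤ (1 - u) * atiTerm δ s (t + 1) m +
        u * (atiTerm δ s (t + 1) m * Real.exp (atiTilt δ s)) := by
        gcongr
        linarith
    _ = atiTerm δ s (t + 1) m * (1 - u + u * Real.exp (atiTilt δ s)) := by ring
    _ ≤ _ := by
      gcongr
      nlinarith

/-- Before the deciding increment the counter may still be below the threshold by at most 1. The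
loss exp(-a) is repaid by the factor (1 + exp a)/2 of that round, leaving at least 1/2. -/
theorem le_atiTerm_self {u : ℝ} (hu : u ≤ 1 / 2) {δ : ℝ} {t m : ℕ}
    (h : ((m + 1 : ℕ) : ℝ) > atiThreshold δ t) : u ≤ atiTerm δ t t m := by
  have ha := atiTilt_nonneg δ t
  have h1 : atiTerm δ t t m = Real.exp (atiTilt δ t * (m - atiThreshold δ t)) *
      Real.exp (atiTilt δ t / 2 + atiTilt δ t ^ 2 / 8) := by
    unfold atiTerm
    rw [← Real.exp_add]
    congr 1
    ring
  have h2 := one_add_exp_div_two_le (atiTilt δ t)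
  have h3 : 1 ≤ Real.exp (atiTilt δ t * (m - atiThreshold δ t)) * Real.exp (atiTilt δ t) := by
    rw [← Real.exp_add]
    apply Real.one_le_exp
    push_cast at h
    nlinarith
  have h4 := Real.exp_pos (atiTilt δ t * (m - atiThreshold δ t))
  rw [h1]
  nlinarith

/-- With L the logarithm and a the tilt, the exponent is -2L - a + L: the deviation above t/2
contributes -2L and the variance term +L. -/
theorem atiTerm_one_zero_le {δ : ℝ} (hδ : 0 < δ) (hδ1 : δ ≤ 1) {s : ℕ} (hs : 0 < s) :
    atiTerm δ s 1 0 ≤ Real.exp (-Real.log (Real.pi ^ 2 * (s : ℝ) ^ 2 / (3 * δ))) := by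
  have hs' : (0 : ℝ) < s := by exact_mod_cast hs
  have hL := log_pi_sq_nonneg hδ hδ1 hs
  have ha := atiTilt_nonneg δ s
  unfold atiTerm atiThreshold
  set L := Real.log (Real.pi ^ 2 * (s : ℝ) ^ 2 / (3 * δ)) with hLdef
  set r := Real.sqrt (s / 2 * L) with hr
  have hr2 : r ^ 2 = s / 2 * L := Real.sq_sqrt (by positivity)
  have ha' : atiTilt δ s = 4 * r / s := rfl
  have h1 : atiTilt δ s * r = 2 * L := by
    rw [ha']
    field_simp
    linear_combination 4 * hr2
  have h2 : atiTilt δ s ^ 2 * s = 8 * L := by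
    rw [ha']
    field_simp
    linear_combination 16 * hr2
  apply Real.exp_le_exp.2
  push_cast
  nlinarith

/-- The threshold is at least t/2 + 1 ≥ t for t ≤ 2, so no insertion happens in the first two
rounds. -/
theorem le_atiThreshold {δ : ℝ} {t m : ℕ} (hm : m + 1 ≤ t) (ht : t < 3) :
    ¬ ((m + 1 : ℕ) : ℝ) > atiThreshold δ t := by
  rw [not_lt, atiThreshold]
  have := Real.sqrt_nonneg (t / 2 * Real.log (Real.pi ^ 2 * (t : ℝ) ^ 2 / (3 * δ)))
  have h1 : ((m + 1 : ℕ) : ℝ) ≤ t := by exact_mod_cast hm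
  have h2 : (t : ℝ) ≤ 2 := by exact_mod_cast (by omega : t ≤ 2)
  linarith

/-! ### Failure probabilities of Attempting-Insertion -/

section

variable {n : ℕ} {I : Instance n} {i : Fin n} {S : List (Fin n)} {T : PIT n} {F : ℕ}
  {g : Option (Option (List (Fin n))) → ENNReal} {ε δ η : ℝ}

/-- The supersolution is split into a sum for wrong insertions during the rounds, worth at most δ/5,
and a function `fin` for what happens after the last round. Only `fin` still has to be chosen, and
its inequalities no longer involve the stopping rule. -/
theorem val_ati_le {fin : ℕ → ℤ → ℕ → ℝ} (hn : 2 ≤ n) (hT : InsertionTree I i S T) (hε : 0 < ε)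
    (hε1 : ε < 1 / 2) (hδ : 0 < δ) (hδ1 : δ ≤ 1)
    (hη : ∀ u : ℝ, u ≤ 1 → (ε ≤ I.gap i → u ≤ 1 / 16) → u ≤ η)
    (hg1 : ∀ v, g v ≤ 1) (hg : ∀ S', I.Inserted i S S' → g (some (some S')) = 0)
    (hfin : ∀ k φ m, 0 ≤ fin k φ m)
    (hleaf : ∀ φ (m : ℕ), (m : ℤ) ≤ φ → 1 + 5 / 16 * (atiRounds S.length δ : ℝ) ≤ m →
      1 ≤ fin 0 φ m)
    (hunsure : ∀ (φ : ℤ) (m : ℕ), -(1 + 5 / 16 * (atiRounds S.length δ : ℝ)) < φ →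
      g (some none) ≤ ENNReal.ofReal (fin 0 φ m))
    (hstep : ∀ k φ u, 0 ≤ u → u ≤ η →
      (1 - u) * fin k (φ - 1) 0 + u * fin k (φ + 1) 0 ≤ fin (k + 1) φ 0)
    (hstep_wrong : ∀ k φ m u, 0 ≤ u → u ≤ η → u ≤ 1 / 2 →
      (1 - u) * fin k (φ - 1) (m - 1) + u * fin k (φ + 1) (m + 1) ≤ fin (k + 1) φ m) :
    val I.p F (ati T i S ε δ) g ≤ ENNReal.ofReal
      (δ / 5 + fin (atiRounds S.length δ) (T.path (I.above i) []).length 0) := by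
  set Ψ : ℕ → ℕ → ℤ → ℕ → ℝ := fun k t φ m =>
    ∑ s ∈ (Finset.Ico t (t + k)).filter (3 ≤ ·), atiTerm δ s t m + fin k φ m with hΨ
  have hsum0 : ∀ (A : Finset ℕ) t m, 0 ≤ ∑ s ∈ A, atiTerm δ s t m := fun A t m =>
    Finset.sum_nonneg fun s _ => (atiTerm_pos δ s t m).le
  have hico : ∀ k t, (Finset.Ico (t + 1) (t + 1 + k)).filter (3 ≤ ·) ⊆
      (Finset.Ico t (t + (k + 1))).filter (3 ≤ ·) := fun k t =>
    Finset.filter_subset_filter _ (Finset.Ico_subset_Ico (by omega) (by omega))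
  have main := val_atiLoop_le (F := F) (Ψ := Ψ) hn hT hε hε1 hη hg1 hg (δ := δ)
    (fun k t φ m => add_nonneg (hsum0 _ _ _) (hfin k φ m))
    (fun t φ m h1 h2 => by
      have := hleaf φ m h1 h2
      have := hsum0 ((Finset.Ico t (t + 0)).filter (3 ≤ ·)) t m
      simp only [hΨ]
      linarith)
    (fun t φ m h => (hunsure φ m h).trans (ENNReal.ofReal_le_ofReal (by
      have := hsum0 ((Finset.Ico t (t + 0)).filter (3 ≤ ·)) t m
      simp only [hΨ]
      linarith)))
    (fun k t φ u hu0 hu => by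
      have h1 := hstep k φ u hu0 hu
      have h2 : ∑ s ∈ (Finset.Ico (t + 1) (t + 1 + k)).filter (3 ≤ ·), atiTerm δ s (t + 1) 0 ≤
          ∑ s ∈ (Finset.Ico t (t + (k + 1))).filter (3 ≤ ·), atiTerm δ s t 0 :=
        (Finset.sum_le_sum fun s _ => atiTerm_succ_le δ s t 0).trans
          (Finset.sum_le_sum_of_subset_of_nonneg (hico k t) fun s _ _ => (atiTerm_pos _ _ _ _).le)
      simp only [hΨ]
      linarith)
    (fun k t φ m u hu0 hu hu2 hmt => by
      have h1 := hstep_wrong k φ m u hu0 hu hu2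
      have h2 : (1 - u) *
          ∑ s ∈ (Finset.Ico (t + 1) (t + 1 + k)).filter (3 ≤ ·), atiTerm δ s (t + 1) (m - 1) +
          u * ∑ s ∈ (Finset.Ico (t + 1) (t + 1 + k)).filter (3 ≤ ·),
            atiTerm δ s (t + 1) (m + 1) ≤
          ∑ s ∈ (Finset.Ico (t + 1) (t + 1 + k)).filter (3 ≤ ·), atiTerm δ s t m := by
        rw [Finset.mul_sum, Finset.mul_sum, ← Finset.sum_add_distrib]
        exact Finset.sum_le_sum fun s _ => atiTerm_step hu2 δ s t m
      simp only [hΨ]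
      split_ifs with hthr
      · have ht : 3 ≤ t := by
          by_contra h
          exact le_atiThreshold hmt (by omega) hthr
        -- The term s = t is set aside to pay for the insertion that may happen in this very round.
        have h3 : (Finset.Ico t (t + (k + 1))).filter (3 ≤ ·) =
            insert t ((Finset.Ico (t + 1) (t + 1 + k)).filter (3 ≤ ·)) := by
          ext s
          simp only [Finset.mem_filter, Finset.mem_Ico, Finset.mem_insert]
          omega
        rw [h3, Finset.sum_insert (by simp)]
        have h4 := le_atiTerm_self hu2 hthr
        have h5 := mul_nonneg hu0 (hfin k (φ + 1) (m + 1))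
        have h6 := mul_nonneg hu0 (hsum0 ((Finset.Ico (t + 1) (t + 1 + k)).filter (3 ≤ ·))
          (t + 1) (m + 1))
        linarith
      · have h3 := Finset.sum_le_sum_of_subset_of_nonneg (hico k t)
          (f := fun s => atiTerm δ s t m) fun s _ _ => (atiTerm_pos _ _ _ _).le
        linarith)
    (atiRounds S.length δ) 1 (X := []) (c := fun _ => 0) trivial (fun _ _ => rfl)
    (fun h => absurd h (lt_irrefl _)) le_rfl
  rw [potential_zero, wrongCount_zero] at main
  refine main.trans (ENNReal.ofReal_le_ofReal ?_)
  simp only [hΨ]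
  have hadd : addrDist (T.path (I.above i) []) [] = (T.path (I.above i) []).length := rfl
  rw [hadd]
  gcongr
  refine (Finset.sum_le_sum fun s hs => atiTerm_one_zero_le hδ hδ1 ?_).trans
    (sum_exp_neg_log_tail_le hδ fun s hs => (Finset.mem_filter.1 hs).2)
  have := (Finset.mem_filter.1 hs).2
  omega

theorem exp_neg_atiRounds_le (l : ℕ) (hδ : 0 < δ) :
    Real.exp (-(25 / 512 * atiRounds l δ)) ≤ δ / 2 := by
  have h1 : 512 / 25 * Real.log (2 / δ) ≤ atiRounds l δ :=
    (le_max_right _ _).trans (Nat.le_ceil _)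
  calc _ ≤ Real.exp (-Real.log (2 / δ)) := Real.exp_le_exp.2 (by linarith)
    _ = δ / 2 := by
      rw [Real.exp_neg, Real.exp_log (by positivity), inv_div]

/-- A wrong counter is dominated by a fair walk reflected between 0 and -1. Evenness of cosh about
-1/2 absorbs the truncated step at 0. The tilt 5/16 matches the final threshold of slope 5/16 and
gives exp(-25R/512), which explains the constant 512/25 in the number of rounds R. -/
theorem val_ati_wrong_le (hn : 2 ≤ n) (hT : InsertionTree I i S T) (hε : 0 < ε)
    (hε1 : ε < 1 / 2) (hδ : 0 < δ) (hδ1 : δ ≤ 1)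
    (hg1 : ∀ v, g v ≤ 1) (hg : ∀ S', I.Inserted i S S' → g (some (some S')) = 0)
    (hg0 : g (some none) = 0) : val I.p F (ati T i S ε δ) g ≤ ENNReal.ofReal δ := by
  set R := atiRounds S.length δ with hR
  set A : ℝ := 5 / 16 * (1 + 5 / 16 * R + 1 / 2) with hA
  refine (val_ati_le (η := 1) (fin := fun k _ m =>
    Real.cosh (5 / 16 * (m + 1 / 2)) * Real.cosh (5 / 16) ^ k / Real.cosh A)
    hn hT hε hε1 hδ hδ1 (fun u h _ => h) hg1 hg ?_ ?_ ?_ ?_ ?_).trans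
    (ENNReal.ofReal_le_ofReal ?_)
  · intro k φ m
    have h1 := Real.cosh_pos (5 / 16 * (m + 1 / 2))
    have h2 := Real.cosh_pos (5 / 16)
    have h3 := Real.cosh_pos A
    positivity
  · intro φ m _ hm
    rw [pow_zero, mul_one, one_le_div (Real.cosh_pos A), Real.cosh_le_cosh, abs_of_nonneg,
      abs_of_nonneg, hA]
    · linarith
    · positivity
    · positivity
  · intro φ m _
    rw [hg0]
    exact zero_le
  · intro k φ u _ _
    have h1 := Real.one_le_cosh (5 / 16)
    have h2 := Real.cosh_pos (5 / 16 * (((0 : ℕ) : ℝ) + 1 / 2))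
    have h3 := Real.cosh_pos A
    rw [← add_mul, sub_add_cancel, one_mul, pow_succ]
    gcongr
    have h4 : 0 < Real.cosh (5 / 16) ^ k := by positivity
    nlinarith
  · intro k φ m u hu0 _ hu2
    have h2 := Real.cosh_pos (5 / 16)
    have h3 := Real.cosh_pos A
    have e1 : Real.cosh (5 / 16 * (((m - 1 : ℕ) : ℝ) + 1 / 2)) =
        Real.cosh (5 / 16 * ((m : ℝ) + 1 / 2) - 5 / 16) := by
      rcases m with _ | m
      · rw [← Real.cosh_neg]
        congr 1
        norm_num
      · congr 1
        push_cast [Nat.add_sub_cancel]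
        ring
    have e2 : Real.cosh (5 / 16 * (((m + 1 : ℕ) : ℝ) + 1 / 2)) =
        Real.cosh (5 / 16 * ((m : ℝ) + 1 / 2) + 5 / 16) := by
      congr 1
      push_cast
      ring
    have h5 : (1 - u) * Real.cosh (5 / 16 * (((m - 1 : ℕ) : ℝ) + 1 / 2)) +
        u * Real.cosh (5 / 16 * (((m + 1 : ℕ) : ℝ) + 1 / 2)) ≤
        Real.cosh (5 / 16 * ((m : ℝ) + 1 / 2)) * Real.cosh (5 / 16) := by
      rw [e1, e2, Real.cosh_add, Real.cosh_sub]
      have h6 : 0 ≤ Real.sinh (5 / 16 * ((m : ℝ) + 1 / 2)) := Real.sinh_nonneg_iff.2 (by positivity)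
      have h7 : 0 ≤ Real.sinh (5 / 16) := Real.sinh_nonneg_iff.2 (by norm_num)
      nlinarith [mul_nonneg h6 h7]
    rw [← mul_div_assoc, ← mul_div_assoc, ← add_div, pow_succ]
    gcongr
    have h4 : 0 < Real.cosh (5 / 16) ^ k := by positivity
    nlinarith
  · have h1 : Real.cosh (5 / 16 * (((0 : ℕ) : ℝ) + 1 / 2)) ≤ Real.exp (5 / 32) := by
      rw [Real.cosh_eq]
      have : Real.exp (-(5 / 16 * (((0 : ℕ) : ℝ) + 1 / 2))) ≤ Real.exp (5 / 32) :=
        Real.exp_le_exp.2 (by norm_num)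
      have : Real.exp (5 / 16 * (((0 : ℕ) : ℝ) + 1 / 2)) ≤ Real.exp (5 / 32) :=
        Real.exp_le_exp.2 (by norm_num)
      linarith
    have h2 : Real.cosh (5 / 16) ^ R ≤ Real.exp (25 / 512 * R) := by
      have := Real.cosh_le_exp_half_sq (5 / 16)
      calc _ ≤ Real.exp ((5 / 16) ^ 2 / 2) ^ R :=
            pow_le_pow_left₀ (Real.cosh_pos _).le this _
        _ = _ := by
          rw [← Real.exp_nat_mul]
          congr 1
          ring
    have h3 : Real.exp A / 2 ≤ Real.cosh A := by
      rw [Real.cosh_eq]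
      have := Real.exp_pos (-A)
      linarith
    have h4 := exp_neg_atiRounds_le S.length hδ
    rw [← hR] at h4
    have h5 : Real.exp (-(5 / 16)) ≤ 4 / 5 := by
      rw [Real.exp_neg, inv_le_comm₀ (Real.exp_pos _) (by norm_num)]
      have := Real.add_one_le_exp (5 / 16)
      -- The end error 4δ/5 and the running error δ/5 exhaust the confidence parameter.
      linarith
    have h6 : Real.cosh (5 / 16 * (((0 : ℕ) : ℝ) + 1 / 2)) * Real.cosh (5 / 16) ^ R /
        Real.cosh A ≤ 4 / 5 * δ := by
      rw [div_le_iff₀ (Real.cosh_pos A)]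
      calc _ ≤ Real.exp (5 / 32) * Real.exp (25 / 512 * R) := by
            gcongr
        _ = 2 * (Real.exp (-(5 / 16)) * Real.exp (-(25 / 512 * R))) * (Real.exp A / 2) := by
            rw [show ∀ a b c : ℝ, 2 * (a * b) * (c / 2) = a * b * c by intros; ring,
              ← Real.exp_add, ← Real.exp_add, ← Real.exp_add]
            congr 1
            rw [hA]
            ring
        _ ≤ 2 * (4 / 5 * (δ / 2)) * Real.cosh A := by
            have := Real.exp_pos A
            gcongr
        _ = _ := by ring
    linarith

/-- The exponential moment with base 2 contracts by 15/16 · 1/2 + 1/16 · 2 = 19/32 per round. Any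
failure after the last round requires a potential above -(1 + 5R/16), where the moment is at least
1. -/
theorem val_ati_le_of_le_gap (hn : 2 ≤ n) (hT : InsertionTree I i S T) (hε : 0 < ε)
    (hdepth : T.depth = ⌈1 + Real.logb 2 (S.length + 1)⌉₊)
    (hε1 : ε < 1 / 2) (hgap : ε ≤ I.gap i) (hδ : 0 < δ) (hδ1 : δ ≤ 1)
    (hg1 : ∀ v, g v ≤ 1) (hg : ∀ S', I.Inserted i S S' → g (some (some S')) = 0) :
    val I.p F (ati T i S ε δ) g ≤ ENNReal.ofReal δ := by
  set R := atiRounds S.length δ with hR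
  have hR0 : (0 : ℝ) ≤ R := Nat.cast_nonneg _
  have hpow : ∀ φ : ℤ, (2 : ℝ) ^ (((φ - 1 : ℤ) : ℝ) + (1 + 5 / 16 * R)) =
      (2 : ℝ) ^ ((φ : ℝ) + (1 + 5 / 16 * R)) * (1 / 2) ∧
      (2 : ℝ) ^ (((φ + 1 : ℤ) : ℝ) + (1 + 5 / 16 * R)) =
      (2 : ℝ) ^ ((φ : ℝ) + (1 + 5 / 16 * R)) * 2 := by
    intro φ
    constructor
    · rw [show (((φ - 1 : ℤ) : ℝ) + (1 + 5 / 16 * R)) = (φ : ℝ) + (1 + 5 / 16 * R) - 1 by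
        push_cast; ring, Real.rpow_sub two_pos, Real.rpow_one]
      ring
    · rw [show (((φ + 1 : ℤ) : ℝ) + (1 + 5 / 16 * R)) = (φ : ℝ) + (1 + 5 / 16 * R) + 1 by
        push_cast; ring, Real.rpow_add two_pos, Real.rpow_one]
  have hstep : ∀ (k : ℕ) (φ : ℤ) (u : ℝ), u ≤ 1 / 16 →
      (1 - u) * ((2 : ℝ) ^ (((φ - 1 : ℤ) : ℝ) + (1 + 5 / 16 * R)) * (19 / 32) ^ k) +
      u * ((2 : ℝ) ^ (((φ + 1 : ℤ) : ℝ) + (1 + 5 / 16 * R)) * (19 / 32) ^ k) ≤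
      (2 : ℝ) ^ ((φ : ℝ) + (1 + 5 / 16 * R)) * (19 / 32) ^ (k + 1) := by
    intro k φ u hu
    rw [(hpow φ).1, (hpow φ).2, pow_succ]
    have h1 : 0 < (2 : ℝ) ^ ((φ : ℝ) + (1 + 5 / 16 * R)) * (19 / 32) ^ k := by positivity
    nlinarith
  refine (val_ati_le (η := 1 / 16) (fin := fun k φ _ =>
    (2 : ℝ) ^ ((φ : ℝ) + (1 + 5 / 16 * R)) * (19 / 32) ^ k)
    hn hT hε hε1 hδ hδ1 (fun u _ h => h hgap) hg1 hg ?_ ?_ ?_ ?_ ?_).trans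
    (ENNReal.ofReal_le_ofReal ?_)
  · intro k φ m
    positivity
  · intro φ m h1 h2
    rw [pow_zero, mul_one]
    have : (0 : ℝ) ≤ φ := by exact_mod_cast (Int.natCast_nonneg m).trans h1
    exact Real.one_le_rpow one_le_two (by positivity)
  · intro φ m h
    refine (hg1 _).trans ?_
    rw [ENNReal.one_le_ofReal, pow_zero, mul_one]
    rw [← hR] at h
    exact Real.one_le_rpow one_le_two (by linarith)
  · intro k φ u _ hu
    exact hstep k φ u hu
  · intro k φ m u _ hu _
    exact hstep k φ u hu
  -- The initial distance is at most R/4 - 1, so the exponent at the start is at most R/4 + 5R/16 =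
  -- 9R/16. Since 8/5 · 19/32 = 19/20 ≤ exp(-25/512), the end error is at most δ/2.
  · have h1 : 4 * (T.depth : ℝ) ≤ R := by
      rw [hdepth, add_comm (S.length : ℝ)]
      exact (le_max_left _ _).trans (Nat.le_ceil _)
    have h2 : ((T.path (I.above i) []).length : ℝ) + 1 ≤ T.depth := by
      have := PIT.length_path_lt (I.above i) T []
      rw [List.length_nil, zero_add] at this
      exact_mod_cast this
    have h3 : (2 : ℝ) ^ (9 / 16 : ℝ) ≤ 8 / 5 := by
      rw [← pow_le_pow_iff_left₀ (by positivity) (by norm_num) (n := 16) (by norm_num),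
        ← Real.rpow_natCast, ← Real.rpow_mul (by norm_num)]
      norm_num
    have h4 : (2 : ℝ) ^ ((9 / 16 : ℝ) * R) * (19 / 32) ^ R ≤ Real.exp (-(25 / 512 * R)) := by
      rw [Real.rpow_mul_natCast (by norm_num), ← mul_pow]
      have h5 := Real.add_one_le_exp (-(25 / 512))
      calc _ ≤ Real.exp (-(25 / 512)) ^ R := by
            apply pow_le_pow_left₀ (by positivity)
            linarith
        _ = _ := by
          rw [← Real.exp_nat_mul]
          congr 1
          ring
    have h6 : (2 : ℝ) ^ ((((T.path (I.above i) []).length : ℤ) : ℝ) + (1 + 5 / 16 * R)) *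
        (19 / 32) ^ R ≤ (2 : ℝ) ^ ((9 / 16 : ℝ) * R) * (19 / 32) ^ R := by
      gcongr
      · norm_num
      · push_cast
        linarith
    have h7 := exp_neg_atiRounds_le S.length hδ
    rw [← hR] at h7
    linarith

end

/-! ### The number of comparisons of Attempting-Insertion -/

theorem ceil_le_of_le {ε x : ℝ} {K : ℕ} (hε : 0 < ε) (hK : 3 * (1 / ε ^ 2) ≤ K)
    (hx : 1 / 64 ≤ x) :
    ⌈1 / (2 * ε ^ 2) * Real.log (2 / x)⌉₊ ≤ K := by
  apply Nat.ceil_le.2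
  have h1 : Real.log (2 / x) ≤ 6 := by
    calc Real.log (2 / x) ≤ Real.log (2 ^ 7) := by
          apply Real.log_le_log (by positivity)
          rw [div_le_iff₀ (by linarith)]
          linarith
      _ = 7 * Real.log 2 := by
          rw [Real.log_pow]
          norm_num
      _ ≤ 6 := by linarith [Real.log_two_lt_d9]
  calc 1 / (2 * ε ^ 2) * Real.log (2 / x) ≤ 1 / (2 * ε ^ 2) * 6 := by gcongr
    _ = 3 * (1 / ε ^ 2) := by
      field_simp
      norm_num
    _ ≤ K := hK

section

variable {n : ℕ} {p : Fin n → Fin n → unitInterval} {F : ℕ} {i : Fin n} {S : List (Fin n)}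
  {T : PIT n} {ε δ : ℝ}

theorem within_atc {x : ℝ} {K : ℕ} (hε : 0 < ε) (hK : 3 * (1 / ε ^ 2) ≤ K) (hx : 1 / 64 ≤ x)
    (e : ExtItem n) : Within p F (atc i e ε x) K :=
  (within_atcLoop i e x _ 0 0).mono (ceil_le_of_le hε hK hx)

theorem within_atiLoop {K : ℕ} (hε : 0 < ε) (hK : 3 * (1 / ε ^ 2) ≤ K) (k t : ℕ) (X : List Bool)
    (c : List Bool → ℕ) : Within p F (atiLoop T i S ε δ k t X c) (k * (3 * K)) := by
  have h1 : 1 / 64 ≤ 1 - Real.sqrt atiQ := by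
    have : Real.sqrt atiQ ≤ 63 / 64 := by
      rw [Real.sqrt_le_left (by norm_num)]
      norm_num [atiQ]
    linarith
  have h2 : 1 / 64 ≤ 1 - atiQ := by norm_num [atiQ]
  -- This is the smallest of the three confidences; it suffices that (63/64)³ > 15/16.
  have h3 : 1 / 64 ≤ 1 - atiQ ^ (1 / 3 : ℝ) := by
    obtain ⟨s1, s2, s3⟩ := fifteen_le_cbrt_atiQ
    by_contra h
    have h' : 63 / 64 ≤ atiQ ^ (1 / 3 : ℝ) := by linarith
    have : (63 / 64 : ℝ) * (63 / 64) * (63 / 64) ≤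
        atiQ ^ (1 / 3 : ℝ) * atiQ ^ (1 / 3 : ℝ) * atiQ ^ (1 / 3 : ℝ) := by gcongr
    rw [s3] at this
    norm_num at this
  induction k generalizing t X c with
  | zero => exact Within.pure _ _
  | succ k ih =>
    rw [atiLoop]
    rcases T.subtree X with ⟨l, r⟩ | ⟨l, r, m, L, R⟩
    · refine Within.mono ((within_atc hε hK h1 l).bind fun a =>
        (within_atc hε hK h1 r).bind fun b => (?_ : Within p F _ (k * (3 * K)))) (by lia)
      dsimp only
      split_ifs
      · exact Within.pure _ _
      · exact ih _ _ _
      · exact ih _ _ _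
      · exact ih _ _ _
    · dsimp only
      split_ifs
      · refine Within.mono ((within_atc hε hK h2 m).bind fun a =>
          (?_ : Within p F _ (k * (3 * K)))) (by lia)
        split_ifs
        · exact ih _ _ _
        · exact ih _ _ _
      · refine Within.mono ((within_atc hε hK h3 l).bind fun a =>
          (within_atc hε hK h3 r).bind fun b =>
          (?_ : Within p F _ (K + k * (3 * K)))) (by lia)
        split_ifs
        · exact (ih _ _ _).mono (by lia)
        · refine (within_atc hε hK h3 m).bind fun a => ?_
          split_ifs
          · exact ih _ _ _
          · exact ih _ _ _

end

/-! ### Failure probabilities -/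

open Classical in
/-- The probability, with loops cut off after `F` rounds, that the program does not terminate with
a value `a` after `N` comparisons such that `E a N`. -/
noncomputable def failProb {n : ℕ} (p : Fin n → Fin n → unitInterval) (F : ℕ) {α : Type}
    (P : Prog n α) (E : α → ℕ → Prop) : ENNReal :=
  ev (P.run p F) fun x => if ∃ a, x.1 = some a ∧ E a x.2 then 0 else 1

section

variable {n : ℕ} {p : Fin n → Fin n → unitInterval} {F : ℕ} {α β : Type}

theorem failProb_pure {a : α} {E : α → ℕ → Prop} (h : E a 0) :
    failProb p F (pure a : Prog n α) E = 0 := by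
  rw [failProb, run_pure, ev_pure, if_pos ⟨a, rfl, h⟩]

/-- The union bound for sequential composition; the number N already spent is handed on to the event
of the second program. -/
theorem failProb_bind_le {P : Prog n α} {f : α → Prog n β} {E₁ : α → ℕ → Prop}
    {E : β → ℕ → Prop} {b₁ b₂ : ENNReal} (h₁ : failProb p F P E₁ ≤ b₁)
    (h₂ : ∀ a N, E₁ a N → failProb p F (f a) (fun b M => E b (N + M)) ≤ b₂) :
    failProb p F (P >>= f) E ≤ b₁ + b₂ := by
  classical
  rw [failProb, ev_run_bind]
  calc _ ≤ ev (P.run p F) (fun x => (if ∃ a, x.1 = some a ∧ E₁ a x.2 then 0 else 1) + b₂) := by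
        refine ev_mono fun x => ?_
        rcases x with ⟨_ | a, N⟩
        · simp
        · by_cases h : E₁ a N
          · refine le_add_left ?_
            exact h₂ a N h
          · refine le_add_right ?_
            rw [if_neg (c := ∃ a', (some a, N).1 = some a' ∧ E₁ a' (some a, N).2) (by
              rintro ⟨a', h1, h2⟩
              cases h1
              exact h h2)]
            calc _ ≤ ev ((f a).run p F) (fun _ => (1 : ENNReal)) := by
                  refine ev_mono fun v => ?_
                  split_ifs <;> simp
              _ = 1 := ev_const _ _
    _ ≤ _ := by
        rw [ev_add, ev_const]
        gcongr
        exact h₁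

theorem failProb_mono {P : Prog n α} {E E' : α → ℕ → Prop} (h : ∀ a N, E a N → E' a N) :
    failProb p F P E' ≤ failProb p F P E := by
  classical
  refine ev_mono fun x => ?_
  by_cases h' : ∃ a, x.1 = some a ∧ E a x.2
  · obtain ⟨a, h1, h2⟩ := h'
    rw [if_pos ⟨a, h1, h a _ h2⟩]
    exact zero_le
  · rw [if_neg h']
    split_ifs <;> simp

/-- The success probability is a supremum over cut-offs, so a single F gives the bound. -/
theorem le_prob {P : Prog n α} {E : α → ℕ → Prop} {δ : ℝ} (hδ : 0 ≤ δ)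
    (h : failProb p F P E ≤ ENNReal.ofReal δ) : ENNReal.ofReal (1 - δ) ≤ P.prob p E := by
  classical
  refine le_trans ?_ (le_iSup _ F)
  rw [PMF.toOuterMeasure_apply]
  have h1 : ∑' x, {x : Option α × ℕ | ∃ a, x.1 = some a ∧ E a x.2}.indicator (P.run p F) x +
      failProb p F P E = 1 := by
    rw [failProb, ev, ← ENNReal.tsum_add, ← (P.run p F).tsum_coe]
    congr 1
    funext x
    by_cases hx : ∃ a, x.1 = some a ∧ E a x.2
    · rw [Set.indicator_of_mem (by exact hx), if_pos hx]
      simp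
    · rw [Set.indicator_of_notMem (by exact hx), if_neg hx]
      simp
  rw [ENNReal.ofReal_sub _ hδ, ENNReal.ofReal_one, ← h1]
  exact tsub_le_iff_right.2 (by gcongr)

open Classical in
/-- The indicator of the rounds of a loop that end with a value that is not good. -/
noncomputable def wrongRound (good : α → Prop) : Option (Option α) → ENNReal
  | some (some a) => if good a then 0 else 1
  | _ => 0

open Classical in
/-- The indicator of the rounds of a loop that do not end with a good value. -/
noncomputable def failedRound (good : α → Prop) : Option (Option α) → ENNReal
  | some (some a) => if good a then 0 else 1
  | _ => 1

theorem wrongRound_le_one (good : α → Prop) (v) : wrongRound good v ≤ 1 := by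
  classical
  rcases v with _ | _ | a
  · exact zero_le_one
  · exact zero_le_one
  · rw [wrongRound]
    split_ifs <;> simp

theorem failedRound_le_one (good : α → Prop) (v) : failedRound good v ≤ 1 := by
  classical
  rcases v with _ | _ | a
  · exact le_rfl
  · exact le_rfl
  · rw [failedRound]
    split_ifs <;> simp

-- Rounds before N need only avoid a wrong value, as an unsure round merely continues the loop.
-- Round N, if reached, has to produce a good value. The costs add up surely, because each round
-- obeys a sure bound.
open Classical in
theorem ev_runLoop_le {f : ℕ → PMF (Option (Option α) × ℕ)} {good : α → Prop} {B : ℕ → ℕ}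
    {b : ℕ → ENNReal} {N : ℕ} (hB : ∀ t, 1 ≤ t → ∀ x ∈ (f t).support, x.1 ≠ none ∧ x.2 ≤ B t)
    (hwrong : ∀ t, 1 ≤ t → ev (f t) (fun x => wrongRound good x.1) ≤ b t)
    (hlast : ev (f N) (fun x => failedRound good x.1) ≤ b N) (j : ℕ) {k t : ℕ} (hk : j < k)
    (ht : 1 ≤ t) (htj : t + j = N) :
    ev (runLoop f k t) (fun y => if ∃ a, y.1 = some a ∧ good a ∧ y.2 ≤ ∑ s ∈ Finset.Icc t N, B s
      then 0 else 1) ≤ ∑ s ∈ Finset.Icc t N, b s := by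
  induction j generalizing k t with
  | zero =>
    obtain ⟨k, rfl⟩ := Nat.exists_eq_succ_of_ne_zero hk.ne'
    obtain rfl : t = N := htj
    rw [Finset.Icc_self, Finset.sum_singleton, Finset.sum_singleton, runLoop, ev_bind]
    refine (ev_mono_support fun x hx => ?_).trans hlast
    obtain ⟨h1, h2⟩ := hB t ht x hx
    rcases x with ⟨_ | _ | a, M⟩
    · exact absurd rfl h1
    · refine (ev_mono (g' := fun _ => 1) fun y => ?_).trans (ev_const _ _).le
      split_ifs <;> simp
    · simp only [ev_pure, failedRound]
      by_cases ha : good a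
      · rw [if_pos ⟨a, rfl, ha, h2⟩]
        exact zero_le
      · rw [if_neg ha]
        split_ifs <;> simp
  | succ j ih =>
    obtain ⟨k, rfl⟩ := Nat.exists_eq_succ_of_ne_zero (by omega : k ≠ 0)
    have ih' := ih (k := k) (t := t + 1) (by omega) (by omega) (by omega)
    have hIcc : Finset.Icc t N = insert t (Finset.Icc (t + 1) N) := by
      ext s
      simp only [Finset.mem_insert, Finset.mem_Icc]
      omega
    have hnot : t ∉ Finset.Icc (t + 1) N := by simp
    rw [hIcc, Finset.sum_insert hnot, Finset.sum_insert hnot, runLoop, ev_bind]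
    calc _ ≤ ev (f t) (fun x => wrongRound good x.1 + ∑ s ∈ Finset.Icc (t + 1) N, b s) := by
          refine ev_mono_support fun x hx => ?_
          obtain ⟨h1, h2⟩ := hB t ht x hx
          rcases x with ⟨_ | _ | a, M⟩
          · exact absurd rfl h1
          · refine le_add_left (le_trans ?_ ih')
            simp only [ev_map]
            refine ev_mono fun y => ?_
            by_cases hy : ∃ a, y.1 = some a ∧ good a ∧ y.2 ≤ ∑ s ∈ Finset.Icc (t + 1) N, B s
            · obtain ⟨a, e1, e2, e3⟩ := hy
              rw [if_pos ⟨a, e1, e2, add_le_add h2 e3⟩]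
              exact zero_le
            · rw [if_neg hy]
              split_ifs <;> simp
          · simp only [ev_pure, wrongRound]
            by_cases ha : good a
            · rw [if_pos ⟨a, rfl, ha, h2.trans (Nat.le_add_right _ _)⟩]
              exact zero_le
            · refine le_add_right ?_
              rw [if_neg ha]
              split_ifs <;> simp
      _ ≤ _ := by
          rw [ev_add, ev_const]
          gcongr
          exact hwrong t ht

end

/-! ### Iterated insertion and the union bound -/

/-- The confidence parameter of the round `t` of Iterative-Attempting-Insertion. -/
noncomputable def roundDelta (δ : ℝ) (t : ℕ) : ℝ := 6 * δ / (Real.pi ^ 2 * (t : ℝ) ^ 2)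

/-- The number of rounds after which Iterative-Attempting-Insertion has inserted an item with
gap `Δ`. -/
noncomputable def lastRound (Δ : ℝ) : ℕ := ⌈Real.logb 2 Δ⁻¹⌉₊

/-- A bound for the comparisons made by Iterative-Attempting-Insertion. -/
noncomputable def iaiBound (n : ℕ) (δ Δ : ℝ) : ℕ :=
  ∑ t ∈ Finset.Icc 1 (lastRound Δ), atiRounds n (roundDelta δ t) * (3 * (3 * 4 ^ (t + 1)))

theorem roundDelta_pos {δ : ℝ} (hδ : 0 < δ) {t : ℕ} (ht : 1 ≤ t) : 0 < roundDelta δ t := by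
  have ht' : (0 : ℝ) < t := by exact_mod_cast ht
  have := Real.pi_pos
  unfold roundDelta
  positivity

theorem roundDelta_le_one {δ : ℝ} (hδ1 : δ ≤ 1) {t : ℕ} (ht : 1 ≤ t) : roundDelta δ t ≤ 1 := by
  have ht' : (1 : ℝ) ≤ t := by exact_mod_cast ht
  have hpi := Real.pi_gt_three
  unfold roundDelta
  rw [div_le_one (by positivity)]
  have h9 : 9 ≤ Real.pi ^ 2 := by nlinarith
  have ht2 : 1 ≤ (t : ℝ) ^ 2 := by nlinarith
  nlinarith

theorem sum_roundDelta_le {δ : ℝ} (hδ : 0 < δ) (s : Finset ℕ) :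
    ∑ t ∈ s, roundDelta δ t ≤ δ := by
  have hpi := Real.pi_pos
  calc ∑ t ∈ s, roundDelta δ t = 6 * δ / Real.pi ^ 2 * ∑ t ∈ s, 1 / (t : ℝ) ^ 2 := by
        rw [Finset.mul_sum]
        refine Finset.sum_congr rfl fun t _ => ?_
        unfold roundDelta
        rw [div_mul_div_comm, mul_one]
    _ ≤ 6 * δ / Real.pi ^ 2 * (Real.pi ^ 2 / 6) := by
        gcongr
        exact sum_inv_sq_le s
    _ = δ := by field_simp

theorem atiRounds_mono {l l' : ℕ} (h : l ≤ l') (δ : ℝ) : atiRounds l δ ≤ atiRounds l' δ := by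
  unfold atiRounds
  have h1 : ((1 : ℝ) + l) ≤ 1 + l' := by gcongr
  have h2 : Real.logb 2 (1 + l) ≤ Real.logb 2 (1 + l') :=
    Real.logb_le_logb_of_le (by norm_num) (by positivity) h1
  gcongr

theorem two_rpow_neg_eq (t : ℕ) : (2 : ℝ) ^ (-((t : ℝ) + 1)) = (1 / 2) ^ (t + 1) := by
  rw [Real.rpow_neg two_pos.le, one_div, inv_pow]
  congr 1
  exact_mod_cast Real.rpow_natCast 2 (t + 1)

theorem one_le_lastRound {Δ : ℝ} (h0 : 0 < Δ) (h1 : Δ ≤ 1 / 2) : 1 ≤ lastRound Δ := by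
  apply Nat.one_le_iff_ne_zero.2
  apply ne_of_gt
  rw [lastRound, Nat.ceil_pos]
  apply Real.logb_pos (by norm_num)
  rw [lt_inv_comm₀ (by norm_num) h0]
  linarith

theorem half_pow_lastRound_le {Δ : ℝ} (h0 : 0 < Δ) : (1 / 2 : ℝ) ^ (lastRound Δ + 1) ≤ Δ := by
  have h1 : Real.logb 2 Δ⁻¹ ≤ lastRound Δ := Nat.le_ceil _
  rw [Real.logb_le_iff_le_rpow (by norm_num) (by positivity), Real.rpow_natCast] at h1
  have h2 : (1 / 2 : ℝ) ^ lastRound Δ ≤ Δ := by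
    rw [one_div, inv_pow]
    exact inv_le_of_inv_le₀ h0 h1
  have h3 : (0 : ℝ) < (1 / 2) ^ lastRound Δ := by positivity
  rw [pow_succ]
  linarith

section

variable {n : ℕ} {I : Instance n} {tree : List (Fin n) → PIT n}

/-- The last relevant round is the first index N guaranteed to satisfy 2^(-N) ≤ Δ_i; its ε is half
of that, hence below the gap. Starting at τ = 1 keeps ε below 1/2. -/
theorem failProb_iai_le (hn : 2 ≤ n) (htree : ∀ S, IsPIT S (tree S)) {i : Fin n}
    {S : List (Fin n)} (hS : I.Sorted S) (hne : S ≠ []) (hi : i ∉ S) (hlen : S.length ≤ n)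
    {δ : ℝ} (hδ : 0 < δ) (hδ1 : δ ≤ 1) {F : ℕ} (hF : lastRound (I.gap i) < F) :
    failProb I.p F (iai tree i S δ) (fun S' N => I.Inserted i S S' ∧ N ≤ iaiBound n δ (I.gap i)) ≤
      ENNReal.ofReal δ := by
  classical
  have hT := (htree S).insertionTree hS hne hi
  have hg0 := I.gap_pos hn i
  have hg1 := I.gap_le_half hn i
  have hlast := one_le_lastRound hg0 hg1
  have hε : ∀ t : ℕ, 0 < (2 : ℝ) ^ (-((t : ℝ) + 1)) := fun t => by positivity
  have hε1 : ∀ t : ℕ, 1 ≤ t → (2 : ℝ) ^ (-((t : ℝ) + 1)) < 1 / 2 := by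
    intro t ht
    rw [two_rpow_neg_eq, pow_succ]
    have : (1 / 2 : ℝ) ^ t < 1 := pow_lt_one₀ (by norm_num) (by norm_num) (by omega)
    linarith
  have hrun := ev_runLoop_le (α := List (Fin n)) (f := fun t => (ati (tree S) i S
    (2 ^ (-((t : ℝ) + 1))) (6 * δ / (Real.pi ^ 2 * (t : ℝ) ^ 2))).run I.p F)
    (good := I.Inserted i S) (N := lastRound (I.gap i))
    (B := fun t => atiRounds n (roundDelta δ t) * (3 * (3 * 4 ^ (t + 1))))
    (b := fun t => ENNReal.ofReal (roundDelta δ t)) ?_ ?_ ?_ (lastRound (I.gap i) - 1)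
    (k := F) (t := 1) (by omega) le_rfl (by omega)
  · rw [failProb, iai, Prog.run]
    refine (ev_mono fun x => ?_).trans (hrun.trans ?_)
    · by_cases h : ∃ a, x.1 = some a ∧ I.Inserted i S a ∧ x.2 ≤ iaiBound n δ (I.gap i)
      · exact ((if_pos h).trans (if_pos h).symm).le
      · exact ((if_neg h).trans (if_neg h).symm).le
    rw [← ENNReal.ofReal_sum_of_nonneg fun t ht =>
      (roundDelta_pos hδ (Finset.mem_Icc.1 ht).1).le]
    exact ENNReal.ofReal_le_ofReal (sum_roundDelta_le hδ _)
  · intro t ht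
    have h : 3 * (1 / ((2 : ℝ) ^ (-((t : ℝ) + 1))) ^ 2) ≤ ((3 * 4 ^ (t + 1) : ℕ) : ℝ) := by
      rw [two_rpow_neg_eq, ← pow_mul, mul_comm (t + 1), pow_mul, ← one_div_pow]
      norm_num
    refine Within.mono (within_atiLoop (hε t) h _ _ _ _) ?_
    exact Nat.mul_le_mul_right _ (atiRounds_mono hlen _)
  · intro t ht
    exact val_ati_wrong_le hn hT (hε t) (hε1 t ht) (roundDelta_pos hδ ht)
      (roundDelta_le_one hδ1 ht) (wrongRound_le_one _) (fun S' h => by rw [wrongRound, if_pos h])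
      rfl
  · exact val_ati_le_of_le_gap hn hT (hε _) (htree S).1 (hε1 _ hlast)
      (by rw [two_rpow_neg_eq]; exact half_pow_lastRound_le hg0) (roundDelta_pos hδ hlast)
      (roundDelta_le_one hδ1 hlast) (failedRound_le_one _)
      (fun S' h => by rw [failedRound, if_pos h])

theorem failProb_foldlM_le (hn : 2 ≤ n) (htree : ∀ S, IsPIT S (tree S)) {δ : ℝ} (hδ : 0 < δ)
    (hδ1 : δ ≤ 1) {F : ℕ} (hF : ∀ i, lastRound (I.gap i) < F) (rest : List (Fin n))
    {S : List (Fin n)} (hS : I.Sorted S) (hne : S ≠ []) (hnd : (rest ++ S).Nodup) :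
    failProb I.p F (rest.foldlM (fun Ans i => iai tree i Ans δ) S)
      (fun S' N => I.Sorted S' ∧ S'.Perm (rest ++ S) ∧
        N ≤ (rest.map fun i => iaiBound n δ (I.gap i)).sum) ≤
      rest.length * ENNReal.ofReal δ := by
  induction rest generalizing S with
  | nil =>
    rw [List.foldlM_nil, failProb_pure ⟨hS, List.Perm.refl _, le_rfl⟩]
    exact zero_le
  | cons i rest ih =>
    have hi : i ∉ S := fun h =>
      (List.nodup_cons.1 hnd).1 (List.mem_append_right _ h)
    have hlen : S.length ≤ n := by
      have h1 := hnd.length_le_card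
      rw [Fintype.card_fin, List.length_append] at h1
      omega
    rw [List.foldlM_cons, List.length_cons, Nat.cast_succ, add_comm, add_mul, one_mul]
    refine failProb_bind_le (failProb_iai_le hn htree hS hne hi hlen hδ hδ1 (hF i))
      fun S' N hS' => ?_
    obtain ⟨⟨h1, h2⟩, h3⟩ := hS'
    have hperm : (rest ++ S').Perm (i :: rest ++ S) :=
      (h2.append_left rest).trans (List.perm_middle)
    refine (failProb_mono fun S'' M h => ?_).trans
      (ih h1 (fun h => by rw [h] at h2; exact (List.cons_ne_nil _ _ h2.nil_eq.symm))
        (hperm.nodup_iff.2 hnd))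
    obtain ⟨h4, h5, h6⟩ := h
    refine ⟨h4, h5.trans hperm, ?_⟩
    rw [List.map_cons, List.sum_cons]
    exact add_le_add h3 h6

theorem failProb_iir_le (hn : 2 ≤ n) (htree : ∀ S, IsPIT S (tree S)) {δ : ℝ} (hδ : 0 < δ)
    (hδ1 : δ < 1) : ∃ F, failProb I.p F (iir tree δ) (fun ans N => ans = I.trueRanking ∧
      N ≤ ∑ i, iaiBound n (δ / ((n : ℝ) - 1)) (I.gap i)) ≤ ENNReal.ofReal δ := by
  have hn' : (2 : ℝ) ≤ n := by exact_mod_cast hn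
  have hδn : 0 < δ / ((n : ℝ) - 1) := div_pos hδ (by linarith)
  have hδn1 : δ / ((n : ℝ) - 1) ≤ 1 := by
    rw [div_le_one (by linarith)]
    linarith
  -- One cut-off exceeds the last relevant rounds of all items.
  refine ⟨Finset.univ.sup (fun i => lastRound (I.gap i)) + 1, ?_⟩
  have hF : ∀ i, lastRound (I.gap i) < Finset.univ.sup (fun i => lastRound (I.gap i)) + 1 :=
    fun i => Nat.lt_succ_of_le (Finset.le_sup (f := fun i => lastRound (I.gap i))
      (Finset.mem_univ i))
  have hlen : (List.finRange n).length = n := List.length_finRange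
  have hnd := List.nodup_finRange n
  have hsum : ∀ f : Fin n → ℕ, ∑ i, f i = ((List.finRange n).map f).sum := fun f => by
    rw [Fin.sum_univ_def]
  unfold iir
  rcases hl : List.finRange n with _ | ⟨s, rest⟩
  · rw [hl, List.length_nil] at hlen
    omega
  · dsimp only
    have hperm : (rest ++ [s]).Perm (List.finRange n) := by
      rw [hl]
      exact List.perm_append_comm
    rw [hl, List.length_cons] at hlen
    refine (failProb_mono fun S' N h => ?_).trans
      ((failProb_foldlM_le hn htree hδn hδn1 hF rest (S := [s]) (List.pairwise_singleton _ _)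
        (List.cons_ne_nil _ _) (hperm.nodup_iff.2 hnd)).trans ?_)
    · obtain ⟨h1, h2, h3⟩ := h
      refine ⟨I.eq_trueRanking h1 (h2.trans hperm), h3.trans ?_⟩
      rw [hsum, hl, List.map_cons, List.sum_cons]
      exact Nat.le_add_left _ _
    · rw [← ENNReal.ofReal_natCast, ← ENNReal.ofReal_mul (Nat.cast_nonneg _)]
      apply ENNReal.ofReal_le_ofReal
      have : (rest.length : ℝ) = n - 1 := by
        have h := congrArg (Nat.cast (R := ℝ)) hlen
        push_cast at h
        linarith
      rw [this, mul_div_cancel₀ _ (by linarith : (n : ℝ) - 1 ≠ 0)]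

end

/-! ### Numerical estimates for the number of comparisons -/

theorem atiRounds_roundDelta_le {n : ℕ} (hn : 2 ≤ n) {δ : ℝ} (hδ : 0 < δ) (hδ1 : δ < 1) {t N : ℕ}
    (ht : 1 ≤ t) (htN : t ≤ N) :
    (atiRounds n (roundDelta (δ / ((n : ℝ) - 1)) t) : ℝ) ≤
      43 + 27 * Real.log (n / δ) + 42 * Real.log N := by
  have hn' : (2 : ℝ) ≤ n := by exact_mod_cast hn
  have ht' : (1 : ℝ) ≤ t := by exact_mod_cast ht
  have htN' : (t : ℝ) ≤ N := by exact_mod_cast htN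
  have hlog2 := Real.log_two_gt_d9
  have hlog2' := Real.log_two_lt_d9
  have hlogn : 0 ≤ Real.log n := Real.log_nonneg (by linarith)
  have hL : Real.log n ≤ Real.log (n / δ) := by
    apply Real.log_le_log (by linarith)
    rw [le_div_iff₀ hδ]
    nlinarith
  have hlogt : Real.log t ≤ Real.log N := Real.log_le_log (by linarith) htN'
  have hlogt0 : 0 ≤ Real.log t := Real.log_nonneg ht'
  have hpi := Real.pi_pos
  have hpi2 : Real.pi ^ 2 ≤ 12 := by
    have := Real.pi_lt_d2
    nlinarith
  have h1 : (⌈1 + Real.logb 2 (1 + n)⌉₊ : ℝ) ≤ 3 + 3 / 2 * Real.log n := by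
    have h2 : Real.logb 2 (1 + n) ≤ 1 + 3 / 2 * Real.log n := by
      calc Real.logb 2 (1 + n) ≤ Real.logb 2 (2 * n) :=
            Real.logb_le_logb_of_le (by norm_num) (by linarith) (by linarith)
        _ = 1 + Real.log n / Real.log 2 := by
            rw [Real.logb, Real.log_mul (by norm_num) (by linarith), add_div,
              div_self (by linarith)]
        _ ≤ _ := by
            gcongr
            rw [div_le_iff₀ (by linarith)]
            nlinarith
    have h3 : 0 ≤ Real.logb 2 (1 + n) := Real.logb_nonneg (by norm_num) (by linarith)
    have := Nat.ceil_lt_add_one (a := 1 + Real.logb 2 (1 + n)) (by linarith)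
    linarith
  have h2 : Real.log (2 / roundDelta (δ / ((n : ℝ) - 1)) t) ≤
      7 / 5 + 2 * Real.log t + Real.log (n / δ) := by
    have hle : 2 / roundDelta (δ / ((n : ℝ) - 1)) t ≤ 2 ^ 2 * (t : ℝ) ^ 2 * (n / δ) := by
      have hn1 : (0 : ℝ) < n - 1 := by linarith
      have e : 2 / roundDelta (δ / ((n : ℝ) - 1)) t =
          Real.pi ^ 2 / 3 * (t : ℝ) ^ 2 * (((n : ℝ) - 1) / δ) := by
        unfold roundDelta
        field_simp
        norm_num
      rw [e]
      gcongr
      · linarith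
      · linarith
    have hpos : 0 < 2 / roundDelta (δ / ((n : ℝ) - 1)) t :=
      div_pos two_pos (roundDelta_pos (div_pos hδ (by linarith)) ht)
    have := Real.log_le_log hpos hle
    rw [Real.log_mul (by positivity) (by positivity), Real.log_mul (by positivity) (by positivity),
      Real.log_pow, Real.log_pow] at this
    push_cast at this
    linarith
  have h3 : max (4 * (⌈1 + Real.logb 2 (1 + n)⌉₊ : ℝ))
      (512 / 25 * Real.log (2 / roundDelta (δ / ((n : ℝ) - 1)) t)) ≤
      42 + 27 * Real.log (n / δ) + 42 * Real.log N := by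
    apply max_le <;> linarith
  unfold atiRounds
  have h4 : (0 : ℝ) ≤ max (4 * (⌈1 + Real.logb 2 (1 + n)⌉₊ : ℝ))
      (512 / 25 * Real.log (2 / roundDelta (δ / ((n : ℝ) - 1)) t)) :=
    le_max_of_le_left (by positivity)
  have := Nat.ceil_lt_add_one h4
  linarith

theorem sum_four_pow_le (N : ℕ) :
    ∑ t ∈ Finset.Icc 1 N, (3 * (3 * 4 ^ (t + 1)) : ℝ) ≤ 48 * 4 ^ N := by
  induction N with
  | zero => simp
  | succ N ih =>
    rw [Finset.sum_Icc_succ_top (by omega)]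
    have e : (4 : ℝ) ^ (N + 1 + 1) = 16 * 4 ^ N := by ring
    have e' : (4 : ℝ) ^ (N + 1) = 4 * 4 ^ N := by ring
    rw [e, e']
    linarith

theorem lastRound_bounds {Δ : ℝ} (h0 : 0 < Δ) (h1 : Δ ≤ 1 / 2) :
    (4 : ℝ) ^ lastRound Δ ≤ 4 * (Δ ^ 2)⁻¹ ∧
      Real.log (lastRound Δ) ≤ 11 / 10 + Real.log (Real.log Δ⁻¹) := by
  have hlog2 := Real.log_two_gt_d9
  have hinv : 2 ≤ Δ⁻¹ := by
    rw [le_inv_comm₀ two_pos h0]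
    linarith
  have hℓ : Real.log 2 ≤ Real.log Δ⁻¹ := Real.log_le_log two_pos hinv
  have hlb : 0 ≤ Real.logb 2 Δ⁻¹ := Real.logb_nonneg (by norm_num) (by linarith)
  have hN : (lastRound Δ : ℝ) ≤ Real.logb 2 Δ⁻¹ + 1 := (Nat.ceil_lt_add_one hlb).le
  constructor
  · have h2 : (2 : ℝ) ^ lastRound Δ ≤ 2 * Δ⁻¹ := by
      rw [← Real.rpow_natCast]
      calc (2 : ℝ) ^ (lastRound Δ : ℝ) ≤ 2 ^ (Real.logb 2 Δ⁻¹ + 1) :=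
            Real.rpow_le_rpow_of_exponent_le (by norm_num) hN
        _ = _ := by
          rw [Real.rpow_add two_pos, Real.rpow_one, Real.rpow_logb two_pos (by norm_num)
            (by positivity), mul_comm]
    calc (4 : ℝ) ^ lastRound Δ = ((2 : ℝ) ^ lastRound Δ) ^ 2 := by
          rw [← pow_mul, mul_comm, pow_mul]
          norm_num
      _ ≤ (2 * Δ⁻¹) ^ 2 := by gcongr
      _ = _ := by
        rw [mul_pow, inv_pow]
        norm_num
  · have hpos : (0 : ℝ) < lastRound Δ := by exact_mod_cast one_le_lastRound h0 h1
    -- As Δ⁻¹ ≥ 2, the rounding up by 1 at most doubles the binary logarithm, and 2 / log 2 < 3.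
    have h3 : (lastRound Δ : ℝ) ≤ 3 * Real.log Δ⁻¹ := by
      refine hN.trans ?_
      rw [Real.logb, div_add_one (by linarith), div_le_iff₀ (by linarith)]
      nlinarith
    have h4 := Real.log_le_log hpos h3
    rw [Real.log_mul (by norm_num) (by linarith)] at h4
    have h5 : Real.log 3 ≤ 11 / 10 := by
      rw [Real.log_le_iff_le_exp (by norm_num)]
      have e : Real.exp (11 / 10) = Real.exp 1 * Real.exp (1 / 10) := by
        rw [← Real.exp_add]
        norm_num
      have h6 := Real.exp_one_gt_d9
      have h7 := Real.quadratic_le_exp_of_nonneg (x := 1 / 10) (by norm_num)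
      rw [e]
      nlinarith
    linarith

theorem iaiBound_le {n : ℕ} (hn : 2 ≤ n) {δ : ℝ} (hδ : 0 < δ) (hδ1 : δ < 1) {Δ : ℝ} (h0 : 0 < Δ)
    (h1 : Δ ≤ 1 / 2) :
    (iaiBound n (δ / ((n : ℝ) - 1)) Δ : ℝ) ≤
      86400 * ((Δ ^ 2)⁻¹ * (Real.log (Real.log Δ⁻¹) + Real.log (n / δ))) := by
  have hn' : (2 : ℝ) ≤ n := by exact_mod_cast hn
  obtain ⟨hpow, hlogN⟩ := lastRound_bounds h0 h1
  have hlog2 := Real.log_two_gt_d9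
  have hinv : 2 ≤ Δ⁻¹ := by
    rw [le_inv_comm₀ two_pos h0]
    linarith
  have hℓ : Real.log 2 ≤ Real.log Δ⁻¹ := Real.log_le_log two_pos hinv
  -- The iterated logarithm can be negative, but it stays above log log 2, and log(n/δ) ≥ log 2
  -- compensates: their sum is bounded below by a positive constant. That is why additive constants
  -- can be absorbed into the factor 450.
  have hx : -(9 / 20) ≤ Real.log (Real.log Δ⁻¹) := by
    have h2 : Real.log (20 / 29) ≤ Real.log (Real.log Δ⁻¹) :=
      Real.log_le_log (by norm_num) (by linarith)
    have h3 := Real.one_sub_inv_le_log_of_pos (x := 20 / 29) (by norm_num)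
    norm_num at h3
    linarith
  have hL : Real.log 2 ≤ Real.log (n / δ) := by
    apply Real.log_le_log two_pos
    rw [le_div_iff₀ hδ]
    nlinarith
  set x := Real.log (Real.log Δ⁻¹)
  set L := Real.log (n / δ)
  have hM : ∀ t ∈ Finset.Icc 1 (lastRound Δ),
      ((atiRounds n (roundDelta (δ / ((n : ℝ) - 1)) t) * (3 * (3 * 4 ^ (t + 1))) : ℕ) : ℝ) ≤
      450 * (x + L) * (3 * (3 * 4 ^ (t + 1))) := by
    intro t ht
    rw [Finset.mem_Icc] at ht
    have := atiRounds_roundDelta_le hn hδ hδ1 ht.1 ht.2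
    push_cast
    gcongr
    linarith
  have hxL : 0 ≤ x + L := by linarith
  unfold iaiBound
  rw [Nat.cast_sum]
  calc _ ≤ ∑ t ∈ Finset.Icc 1 (lastRound Δ), 450 * (x + L) * (3 * (3 * 4 ^ (t + 1))) :=
        Finset.sum_le_sum hM
    _ = 450 * (x + L) * ∑ t ∈ Finset.Icc 1 (lastRound Δ), (3 * (3 * 4 ^ (t + 1)) : ℝ) := by
        rw [Finset.mul_sum]
    _ ≤ 450 * (x + L) * (48 * (4 * (Δ ^ 2)⁻¹)) := by
        gcongr
        exact (sum_four_pow_le _).trans (by gcongr)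
    _ = _ := by ring

end ExactRanking

theorem theorem4 :
    ∃ C : ℝ, 0 < C ∧
      ∀ (n : ℕ), 2 ≤ n →
      ∀ (tree : List (Fin n) → ExactRanking.PIT n),
        (∀ S : List (Fin n), ExactRanking.IsPIT S (tree S)) →
      ∀ (δ : ℝ), 0 < δ → δ < 1 →
      ∀ (I : ExactRanking.Instance n),
        ENNReal.ofReal (1 - δ) ≤
          (ExactRanking.iir tree δ).prob I.p fun ans N =>
            ans = I.trueRanking ∧
            (N : ℝ) ≤ C * ∑ i : Fin n, ((I.gap i) ^ 2)⁻¹ *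
              (Real.log (Real.log (I.gap i)⁻¹) + Real.log (n / δ)) := by
  -- 86400 = 450 · 48 · 4: rounds of Attempting-Insertion, the geometric sum, and the rounding of
  -- the last round.
  refine ⟨86400, by norm_num, fun n hn tree htree δ hδ hδ1 I => ?_⟩
  obtain ⟨F, hF⟩ := ExactRanking.failProb_iir_le (I := I) hn htree hδ hδ1
  refine ExactRanking.le_prob hδ.le ((ExactRanking.failProb_mono fun ans N h => ?_).trans hF)
  refine ⟨h.1, ?_⟩
  calc (N : ℝ) ≤ ((∑ i, ExactRanking.iaiBound n (δ / ((n : ℝ) - 1)) (I.gap i) : ℕ) : ℝ) := by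
        exact_mod_cast h.2
    _ ≤ _ := by
      rw [Nat.cast_sum, Finset.mul_sum]
      exact Finset.sum_le_sum fun i _ => ExactRanking.iaiBound_le hn hδ hδ1 (I.gap_pos hn i)
        (I.gap_le_half hn i)
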